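/- **Setting.** Let $q_0,q_1,q_2\in\mathbb R^2$ be the vertices of an equilateral triangle, $F_i(x)=\tfrac12(x-q_i)+q_i$, and let $SG$ be the Sierpinski gasket, the attractor of $F_0,F_1,F_2$, with its natural probability measure $\mu$ (mass $3^{-m}$ on each cell $F_w(SG)$, $|w|=m$, where $F_w=F_{w_1}\circ\dots\circ F_{w_m}$). Let $V_0=\{q_0,q_1,q_2\}$, $V_m=\bigcup_iF_i(V_{m-1})$; write $x\sim_m y$ if $x\ne y$ are vertices of the same cell of level $m$, and $\Delta_mu(x)=\sum_{y\sim_mx}(u(y)-u(x))$. For continuous $u,f$ on $SG$ write $\Delta u=f$ if $\tfrac32 5^m\Delta_mu\to f$ uniformly on $V_m\setminus V_0$ as $m\to\infty$. With indices mod 3, let $$\partial_nu(q_i)=\lim_{m\to\infty}(\tfrac53)^m\big(2u(q_i)-u(F_i^mq_{i+1})-u(F_i^mq_{i-1})\big),\qquad \partial_Tu(q_i)=\lim_{m\to\infty}5^m\big(u(F_i^mq_{i+1})-u(F_i^mq_{i-1})\big).$$ For $j\ge0$ let $P_{j3}$ be the function with $\Delta^{j+1}P_{j3}=0$ and, for $0\le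 m\le j$, $\Delta^mP_{j3}(q_0)=0$, $\partial_n\Delta^mP_{j3}(q_0)=0$, $\partial_T\Delta^mP_{j3}(q_0)=\delta_{m,j}$. Let $\psi_z^{(m)}$ be the continuous function that is harmonic ($\Delta(\psi_z^{(m)}\circ F_w)=0$) on every cell of level $m$, with $\psi_z^{(m)}(x)=\delta_{zx}$ for $x\in V_m$. Green's function is $$G(x,y)=\lim_{M\to\infty}\sum_{m=0}^M\ \sum_{z,z'\in V_{m+1}\setminus V_m}g(z,z')\,\psi_z^{(m+1)}(x)\,\psi_{z'}^{(m+1)}(y),$$ where, for $z,z'\in V_{m+1}\setminus V_m$, $g(z,z)=\tfrac9{50}(\tfrac35)^m$, $g(z,z')=\tfrac3{50}(\tfrac35)^m$ if $z\ne z'$ lie in the same cell of level $m+1$, and $g(z,z')=0$ otherwise. With $\langle u,v\rangle=\int_{SG}uv\,d\mu$ and $\|u\|=\langle u,u\rangle^{1/2}$, let $p_j$ be the antisymmetric orthogonal polynomials obtained from $\{P_{j3}\}$ by the Gram–Schmidt process without normalization, $$p_j=P_{j3}-\sum_{l=0}^{j-1}d_l^2\langle P_{j3},p_l\rangle p_l,\qquad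 d_l=\|p_l\|^{-1},$$ so $p_0=P_{03}$, and let $Q_j=d_jp_j$, $Q_{-1}=0$. For $k\ge0$ put $$f_{k+1}(x)=-\int G(x,y)p_k(y)\,d\mu(y),\quad \tilde f_{k+1}(x)=-\int G(x,y)Q_k(y)\,d\mu(y),\quad b_k=d_k^2\langle f_{k+1},p_k\rangle,\quad c_{k+1}=\frac{d_k^2}{d_{k+1}^2}.$$ (The coefficient $c_0$ below only multiplies $Q_{-1}=0$; put $c_0=0$.) **Theorem.** These objects are well defined: each $P_{j3}$ exists and is unique, the limit defining $G(x,y)$ exists for all $x,y\in SG$, $\|p_k\|>0$ for all $k$, and $y\mapsto G(x,y)Q_k(y)$ is $\mu$-integrable for all $k$ and $x$. For every $k\ge0$ and every $x\in SG$, $$\sqrt{c_{k+1}}\,Q_{k+1}(x)=\tilde f_{k+1}(x)-b_kQ_k(x)-\sqrt{c_k}\,Q_{k-1}(x).$$ -/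

import Mathlib

open Filter Topology MeasureTheory

namespace SierpinskiOP

/-- The Euclidean plane. -/
abbrev Plane : Type := EuclideanSpace ℝ (Fin 2)

/-- `q 0, q 1, q 2` are the vertices of a (nondegenerate) equilateral triangle. -/
def IsEquilateral (q : Fin 3 → Plane) : Prop :=
  ∃ a : ℝ, 0 < a ∧ ∀ i j, i ≠ j → dist (q i) (q j) = a

/-- The contraction `F_i x = (x - q_i) / 2 + q_i` of the plane. -/
noncomputable def contraction (q : Fin 3 → Plane) (i : Fin 3) (x : Plane) : Plane :=
  (1 / 2 : ℝ) • (x - q i) + q i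

/-- The point with address `s = (s_0, s_1, …)`, i.e. the limit of
`F_{s_0} ∘ ⋯ ∘ F_{s_n} (x)` as `n → ∞`, written as a series. -/
noncomputable def code (q : Fin 3 → Plane) (s : ℕ → Fin 3) : Plane :=
  ∑' n, (1 / 2 : ℝ) ^ (n + 1) • q (s n)

/-- The Sierpinski gasket: the attractor of the three contractions, as the set of all points with
an address. `gasket_isCompact`, `gasket_nonempty`, `gasket_selfSimilar` and `gasket_unique` below
show that it is the attractor. -/
def gasket (q : Fin 3 → Plane) : Set Plane := Set.range (code q)

/-- Prepend a letter to an address. -/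
def consSeq (i : Fin 3) (s : ℕ → Fin 3) : ℕ → Fin 3
  | 0 => i
  | n + 1 => s n

theorem norm_bound (q : Fin 3 → Plane) (i : Fin 3) : ‖q i‖ ≤ ∑ j, ‖q j‖ :=
  Finset.single_le_sum (f := fun j => ‖q j‖) (fun _ _ => norm_nonneg _) (Finset.mem_univ i)

theorem summable_bound (q : Fin 3 → Plane) :
    Summable fun n : ℕ => (1 / 2 : ℝ) ^ (n + 1) * ∑ j, ‖q j‖ :=
  ((summable_nat_add_iff 1).2 summable_geometric_two).mul_right _

theorem term_bound (q : Fin 3 → Plane) (s : ℕ → Fin 3) (n : ℕ) :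
    ‖(1 / 2 : ℝ) ^ (n + 1) • q (s n)‖ ≤ (1 / 2 : ℝ) ^ (n + 1) * ∑ j, ‖q j‖ := by
  rw [norm_smul, Real.norm_of_nonneg (by positivity)]
  gcongr
  exact norm_bound q _

theorem summable_code (q : Fin 3 → Plane) (s : ℕ → Fin 3) :
    Summable fun n : ℕ => (1 / 2 : ℝ) ^ (n + 1) • q (s n) :=
  Summable.of_norm_bounded (summable_bound q) (term_bound q s)

theorem continuous_code (q : Fin 3 → Plane) : Continuous (code q) := by
  refine continuous_tsum (fun n => ?_) (summable_bound q) (fun n s => term_bound q s n)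
  have h : Continuous fun i : Fin 3 => (1 / 2 : ℝ) ^ (n + 1) • q i := continuous_of_discreteTopology
  exact h.comp (continuous_apply n)

theorem code_eq_contraction (q : Fin 3 → Plane) (s : ℕ → Fin 3) :
    code q s = contraction q (s 0) (code q fun n => s (n + 1)) := by
  have h := (summable_code q s).tsum_eq_zero_add
  have h2 : ∑' n, (1 / 2 : ℝ) ^ (n + 1 + 1) • q (s (n + 1))
      = (1 / 2 : ℝ) • ∑' n, (1 / 2 : ℝ) ^ (n + 1) • q (s (n + 1)) := by
    rw [← (summable_code q fun n => s (n + 1)).tsum_const_smul]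
    refine tsum_congr fun n => ?_
    rw [smul_smul]; congr 1; ring
  unfold code contraction
  rw [h, h2]
  module

theorem contraction_code (q : Fin 3 → Plane) (i : Fin 3) (s : ℕ → Fin 3) :
    contraction q i (code q s) = code q (consSeq i s) := by
  rw [code_eq_contraction q (consSeq i s)]
  rfl

theorem code_const (q : Fin 3 → Plane) (i : Fin 3) : code q (fun _ => i) = q i := by
  have h := code_eq_contraction q (fun _ => i)
  unfold contraction at h
  have h2 : (1 / 2 : ℝ) • (code q (fun _ => i) - q i) = 0 := by
    rw [← add_left_inj (q i), zero_add]
    have h3 := h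
    generalize code q (fun _ => i) = z at h3 ⊢
    have h4 : z - ((1 / 2 : ℝ) • (z - q i) + q i) = 0 := sub_eq_zero.2 h3
    rw [← sub_eq_zero, ← h4]
    module
  rcases smul_eq_zero.1 h2 with h3 | h3
  · norm_num at h3
  · exact sub_eq_zero.1 h3

theorem gasket_isCompact (q : Fin 3 → Plane) : IsCompact (gasket q) :=
  isCompact_range (continuous_code q)

theorem gasket_nonempty (q : Fin 3 → Plane) : (gasket q).Nonempty := Set.range_nonempty _

theorem gasket_selfSimilar (q : Fin 3 → Plane) :
    gasket q = ⋃ i, contraction q i '' gasket q := by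
  ext x
  simp only [Set.mem_iUnion, Set.mem_image, gasket, Set.mem_range]
  constructor
  · rintro ⟨s, rfl⟩
    exact ⟨s 0, _, ⟨_, rfl⟩, (code_eq_contraction q s).symm⟩
  · rintro ⟨i, _, ⟨s, rfl⟩, rfl⟩
    exact ⟨_, (contraction_code q i s).symm⟩

/-- The attractor is unique. -/
theorem gasket_unique (q : Fin 3 → Plane) (K : Set Plane) (hK : IsCompact K) (hne : K.Nonempty)
    (hself : K = ⋃ i, contraction q i '' K) : K = gasket q := by
  have hlim : ∀ (s : ℕ → Fin 3) (y : ℕ → Plane), (∀ n, y n ∈ K) →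
      Tendsto (fun n => (∑ k ∈ Finset.range n, (1 / 2 : ℝ) ^ (k + 1) • q (s k))
        + (1 / 2 : ℝ) ^ n • y n) atTop (𝓝 (code q s)) := by
    intro s y hy
    obtain ⟨C, hC⟩ := hK.isBounded.exists_norm_le
    have h1 := (summable_code q s).hasSum.tendsto_sum_nat
    have h2 : Tendsto (fun n => (1 / 2 : ℝ) ^ n • y n) atTop (𝓝 0) := by
      have h3 : Tendsto (fun n : ℕ => (1 / 2 : ℝ) ^ n * C) atTop (𝓝 0) := by
        simpa using (tendsto_pow_atTop_nhds_zero_of_lt_one (r := (1 / 2 : ℝ)) (by norm_num)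
          (by norm_num)).mul_const C
      refine squeeze_zero_norm (fun n => ?_) h3
      rw [norm_smul, Real.norm_of_nonneg (by positivity)]
      gcongr
      exact hC _ (hy n)
    simpa [code] using h1.add h2
  apply Set.Subset.antisymm
  · have hpre : ∀ x : K, ∃ (i : Fin 3) (y : K), contraction q i y = x := by
      rintro ⟨x, hx⟩
      rw [hself] at hx
      simp only [Set.mem_iUnion, Set.mem_image] at hx
      obtain ⟨i, y, hy, h⟩ := hx
      exact ⟨i, ⟨y, hy⟩, h⟩
    choose a b hab using hpre
    intro x hx
    let y : ℕ → K := fun n => b^[n] ⟨x, hx⟩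
    have hstep : ∀ n, (y n : Plane) = contraction q (a (y n)) (y (n + 1)) := by
      intro n
      rw [show y (n + 1) = b (y n) from Function.iterate_succ_apply' _ _ _]
      exact (hab _).symm
    have hx' : ∀ n, (∑ k ∈ Finset.range n, (1 / 2 : ℝ) ^ (k + 1) • q (a (y k)))
        + (1 / 2 : ℝ) ^ n • (y n : Plane) = x := by
      intro n
      induction n with
      | zero => simp [y]
      | succ n ih =>
        rw [← ih, Finset.sum_range_succ, hstep n, contraction, pow_succ]
        module
    have := hlim (fun n => a (y n)) (fun n => y n) (fun n => (y n).2)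
    simp only [hx'] at this
    exact ⟨_, (tendsto_nhds_unique this tendsto_const_nhds)⟩
  · rintro _ ⟨s, rfl⟩
    obtain ⟨x, hx⟩ := hne
    refine hK.isClosed.mem_of_tendsto (hlim s (fun _ => x) (fun _ => hx)) ?_
    refine Eventually.of_forall fun n => ?_
    have : ∀ n, ∀ s : ℕ → Fin 3, (∑ k ∈ Finset.range n, (1 / 2 : ℝ) ^ (k + 1) • q (s k))
        + (1 / 2 : ℝ) ^ n • x ∈ K := by
      intro n
      induction n with
      | zero => intro s; simpa using hx
      | succ n ih =>
        intro s
        rw [hself]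
        refine Set.mem_iUnion.2 ⟨s 0, _, ih (fun k => s (k + 1)), ?_⟩
        rw [Finset.sum_range_succ', contraction, smul_sub, smul_add, Finset.smul_sum]
        simp only [smul_smul, ← pow_succ']
        module
    exact this n s

/-- The Sierpinski gasket as a space, with the topology and the Borel sets of the plane. -/
abbrev Gasket (q : Fin 3 → Plane) : Type := gasket q

section

variable (q : Fin 3 → Plane)

/-- The boundary point `q_i`, as a point of the gasket. -/
noncomputable def corner (i : Fin 3) : Gasket q := ⟨q i, fun _ => i, code_const q i⟩

/-- The contraction `F_i` as a self-map of the gasket. -/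
noncomputable def F (i : Fin 3) (x : Gasket q) : Gasket q :=
  ⟨contraction q i x, by
    obtain ⟨x, s, rfl⟩ := x
    exact ⟨_, (contraction_code q i s).symm⟩⟩

/-- `F_w = F_{w_1} ∘ ⋯ ∘ F_{w_m}` for a word `w = (w_1, …, w_m)`. The cells of level `m` are the
sets `F_w(SG)` with `w` of length `m`. -/
noncomputable def Fw : List (Fin 3) → Gasket q → Gasket q
  | [] => id
  | i :: w => F q i ∘ Fw w

/-- The natural probability measure on the gasket (mass `3^{-m}` on each cell of level `m`): the
law of the point whose address has independent, uniformly distributed letters. -/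
noncomputable def μ : Measure (Gasket q) :=
  (Measure.infinitePi fun _ : ℕ => (PMF.uniformOfFintype (Fin 3)).toMeasure).map
    (fun s => (⟨code q s, s, rfl⟩ : Gasket q))

instance : IsProbabilityMeasure (μ q) :=
  Measure.isProbabilityMeasure_map
    (Continuous.subtype_mk (continuous_code q) _).measurable.aemeasurable

open Classical in
/-- The vertex set `V_m` of the graph `Γ_m`. -/
noncomputable def V : ℕ → Finset (Gasket q)
  | 0 => Finset.univ.image (corner q)
  | m + 1 => Finset.univ.biUnion fun i => (V m).image (F q i)

/-- The edge relation of `Γ_m`: `x` and `y` are different vertices of the same cell of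
level `m`. -/
def Adj (m : ℕ) (x y : Gasket q) : Prop :=
  x ≠ y ∧ ∃ w : List (Fin 3), w.length = m ∧ ∃ i j, x = Fw q w (corner q i) ∧ y = Fw q w (corner q j)

open Classical in
/-- The graph Laplacian `Δ_m u (x) = ∑_{y ∼_m x} (u y - u x)`. -/
noncomputable def graphLaplacian (m : ℕ) (u : Gasket q → ℝ) (x : Gasket q) : ℝ :=
  ∑ y ∈ (V q m).filter (Adj q m x), (u y - u x)

/-- `u` is in the domain of the Laplacian and `Δ u = f`: both functions are continuous and
`(3/2) 5^m Δ_m u → f` as `m → ∞`, uniformly on `V_m \ V_0`. -/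
def HasLaplacian (u f : Gasket q → ℝ) : Prop :=
  Continuous u ∧ Continuous f ∧ ∀ ε > 0, ∃ M : ℕ, ∀ m ≥ M, ∀ x ∈ V q m, x ∉ V q 0 →
    |3 / 2 * 5 ^ m * graphLaplacian q m u x - f x| < ε

/-- `Δ^k u = f`. -/
def HasLaplacianPow : ℕ → (Gasket q → ℝ) → (Gasket q → ℝ) → Prop
  | 0, u, f => f = u
  | k + 1, u, f => ∃ v, HasLaplacianPow k u v ∧ HasLaplacian q v f

/-- The polynomials of degree at most `j`: `Δ^{j+1} u = 0`. -/
def IsPolynomial (j : ℕ) (u : Gasket q → ℝ) : Prop := HasLaplacianPow q (j + 1) u 0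

/-- The normal derivative of `u` at `q_n` exists and equals `a`. -/
def HasNormalDeriv (u : Gasket q → ℝ) (n : Fin 3) (a : ℝ) : Prop :=
  Tendsto (fun m : ℕ => (5 / 3 : ℝ) ^ m * (2 * u (corner q n)
    - u ((F q n)^[m] (corner q (n + 1))) - u ((F q n)^[m] (corner q (n - 1))))) atTop (𝓝 a)

/-- The tangential derivative of `u` at `q_n` exists and equals `a`. -/
def HasTangentialDeriv (u : Gasket q → ℝ) (n : Fin 3) (a : ℝ) : Prop :=
  Tendsto (fun m : ℕ => (5 : ℝ) ^ m *
    (u ((F q n)^[m] (corner q (n + 1))) - u ((F q n)^[m] (corner q (n - 1))))) atTop (𝓝 a)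

/-- `u` is the monomial `P_{ji}^{(n)}` (`i = 1, 2, 3`): a polynomial of degree at most `j` whose
jet `Δ^m u (q_n)`, `∂_n Δ^m u (q_n)`, `∂_T Δ^m u (q_n)`, `m ≤ j`, has a single nonzero entry, equal
to `1`, at `m = j`, in the `i`-th row. -/
def IsMonomial (n : Fin 3) (i j : ℕ) (u : Gasket q → ℝ) : Prop :=
  IsPolynomial q j u ∧ ∀ m ≤ j, ∃ v, HasLaplacianPow q m u v ∧
    v (corner q n) = (if m = j ∧ i = 1 then 1 else 0) ∧
    HasNormalDeriv q v n (if m = j ∧ i = 2 then 1 else 0) ∧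
    HasTangentialDeriv q v n (if m = j ∧ i = 3 then 1 else 0)

/-- The monomial `P_{ji}^{(n)}`. -/
noncomputable def monomial (n : Fin 3) (i j : ℕ) : Gasket q → ℝ :=
  Classical.epsilon (IsMonomial q n i j)

open Classical in
/-- `ψ` is the function `ψ_z^{(m)}`: continuous, harmonic on every cell of level `m`, equal to `1`
at `z` and to `0` at the other points of `V_m`. -/
def IsTent (m : ℕ) (z : Gasket q) (ψ : Gasket q → ℝ) : Prop :=
  Continuous ψ ∧ (∀ w : List (Fin 3), w.length = m → HasLaplacian q (ψ ∘ Fw q w) 0) ∧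
    ∀ x ∈ V q m, ψ x = if x = z then 1 else 0

/-- The piecewise harmonic function `ψ_z^{(m)}`. -/
noncomputable def tent (m : ℕ) (z : Gasket q) : Gasket q → ℝ :=
  Classical.epsilon (IsTent q m z)

open Classical in
/-- The coefficients `g(z, z')`, for `z, z' ∈ V_{m+1} \ V_m`. -/
noncomputable def greenCoeff (m : ℕ) (z z' : Gasket q) : ℝ :=
  if z = z' then 9 / 50 * (3 / 5) ^ m
  else if Adj q (m + 1) z z' then 3 / 50 * (3 / 5) ^ m
  else 0

open Classical in
/-- The partial sums `G_M` of Green's function. -/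
noncomputable def greenPartial (M : ℕ) (x y : Gasket q) : ℝ :=
  ∑ m ∈ Finset.range (M + 1), ∑ z ∈ V q (m + 1) \ V q m, ∑ z' ∈ V q (m + 1) \ V q m,
    greenCoeff q m z z' * tent q (m + 1) z x * tent q (m + 1) z' y

/-- Green's function `G(x, y) = lim_{M → ∞} G_M(x, y)`. -/
noncomputable def green (x y : Gasket q) : ℝ :=
  limUnder atTop fun M => greenPartial q M x y

/-- The function `-∫ G(·, y) u(y) dμ(y)`. -/
noncomputable def negGreenOp (u : Gasket q → ℝ) (x : Gasket q) : ℝ :=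
  -∫ y, green q x y * u y ∂(μ q)

/-- The inner product of `L²(SG, μ)`. -/
noncomputable def ip (u v : Gasket q → ℝ) : ℝ := ∫ x, u x * v x ∂(μ q)

/-- The norm of `L²(SG, μ)`. -/
noncomputable def l2norm (u : Gasket q → ℝ) : ℝ := √(ip q u u)

/-- The orthogonal polynomials obtained from the antisymmetric monomials
`P_{j3} = P_{j3}^{(0)}` by the Gram-Schmidt process:
`p_j = P_{j3} - ∑_{l < j} d_l² ⟨P_{j3}, p_l⟩ p_l` with `d_l = 1 / ‖p_l‖`. -/
noncomputable def p (j : ℕ) : Gasket q → ℝ := fun x =>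
  monomial q 0 3 j x -
    ∑ l : Fin j, ((l2norm q (p l))⁻¹) ^ 2 * ip q (monomial q 0 3 j) (p l) * p l x
termination_by j
decreasing_by all_goals exact l.2

/-- `d_k = 1 / ‖p_k‖`. -/
noncomputable def d (k : ℕ) : ℝ := (l2norm q (p q k))⁻¹

/-- The orthonormal polynomials `Q_k = d_k p_k`. -/
noncomputable def Q (k : ℕ) : Gasket q → ℝ := fun x => d q k * p q k x

/-- `Q_{k-1}`, with `Q_{-1} = 0`. -/
noncomputable def Qprev : ℕ → Gasket q → ℝ
  | 0 => 0
  | k + 1 => Q q k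

/-- `f_0 = 0` and `f_{k+1} = -∫ G(·, y) p_k(y) dμ(y)`. -/
noncomputable def f : ℕ → Gasket q → ℝ
  | 0 => 0
  | k + 1 => negGreenOp q (p q k)

/-- `f̃_0 = 0` and `f̃_{k+1} = -∫ G(·, y) Q_k(y) dμ(y)`. -/
noncomputable def ftilde : ℕ → Gasket q → ℝ
  | 0 => 0
  | k + 1 => negGreenOp q (Q q k)

/-- `b_k = d_k² ⟨f_{k+1}, p_k⟩`. -/
noncomputable def b (k : ℕ) : ℝ := d q k ^ 2 * ip q (f q (k + 1)) (p q k)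

/-- `c_k = d_{k-1}² / d_k²` for `k ≥ 1`. The value at `k = 0`, where `d_{-1}` is not defined, is
only ever multiplied by `Q_{-1} = 0`. -/
noncomputable def c : ℕ → ℝ
  | 0 => 0
  | k + 1 => d q k ^ 2 / d q (k + 1) ^ 2

end

end SierpinskiOP

/-! Let $S$ be the operator $u\mapsto-\int G(\cdot,y)u(y)\,d\mu(y)$. Two properties give the
recursion. First, $S$ is symmetric in $L^2$, because $G(x,y)=G(y,x)$ (`ip_potential_comm`). Second,
$S$ inverts the Laplacian with zero boundary values (`hasLaplacian_potential`), and
$SP_{j3}-P_{j+1,3}$ is a multiple of $P_{03}$ (`potentialMap_monoMap`), so $S$ raises the degree by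
one. Hence $Sp_k-p_{k+1}$ is a combination of $p_0,\dots,p_k$. By symmetry, $\langle
Sp_k,p_l\rangle=\langle p_k,Sp_l\rangle$ vanishes for $l+1<k$ and equals $\|p_k\|^2$ for $l=k-1$.
This is the usual three-term argument (`GramSchmidtData.recursion_succ`); multiplication by $d_k$
normalizes it.

The analytic work is to make $S$ and the monomials explicit. Barycentric coordinates show that
distinct cells of level one meet only at a junction point, so functions can be built and identities
proved cell by cell, by induction on the level. Harmonic functions come from the 1/5–2/5 rule for
the values at the junction points. Green's function is self-similar: inside one cell of level one,
each level of its series is $3/5$ times the preceding level, and across different cells only the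
zeroth level survives (`greenLevel_F`). Consequently the renormalized energy of $G(\cdot,y)$ against
$\varphi$ is the difference at $y$ of the interpolants of $\varphi$ at levels $m$ and $0$
(`energy_greenFn`). With $\varphi$ the indicator of an interior vertex $x$, the renormalized graph
Laplacian of $Sf$ at $x$ is a weighted average of $f$ near $x$, which tends to $f(x)$ uniformly. A
maximum principle gives uniqueness for the Dirichlet problem.

The monomials are built by applying $S$ and adding the multiple of $P_{03}$ that makes $P_{j3}\circ
F_0=5^{-(j+1)}P_{j3}$ (`mono_comp_F_zero`). Homogeneity and antisymmetry yield the jet at $q_0$;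
distinct eigenvalues yield linear independence, hence $\|p_k\|>0$. Uniqueness of the monomials,
tents and limits identifies these constructions with the objects of the statement. -/

namespace SierpinskiOP

/-! ### Addresses and barycentric coordinates -/

/-- The `k`-th barycentric coordinate of the point with address `s`. -/
noncomputable def wt (k : Fin 3) (s : ℕ → Fin 3) : ℝ :=
  ∑' n, (1 / 2 : ℝ) ^ (n + 1) * if s n = k then 1 else 0

theorem summable_wt (k : Fin 3) (s : ℕ → Fin 3) :
    Summable fun n : ℕ => (1 / 2 : ℝ) ^ (n + 1) * if s n = k then (1 : ℝ) else 0 := by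
  refine Summable.of_nonneg_of_le (fun n => ?_) (fun n => ?_)
    ((summable_nat_add_iff 1).2 summable_geometric_two)
  · split_ifs <;> positivity
  · have : (0 : ℝ) ≤ (1 / 2) ^ (n + 1) := by positivity
    split_ifs <;> simp

theorem wt_nonneg (k : Fin 3) (s : ℕ → Fin 3) : 0 ≤ wt k s :=
  tsum_nonneg fun n => by split_ifs <;> positivity

theorem tsum_half_pow_succ : ∑' n : ℕ, (1 / 2 : ℝ) ^ (n + 1) = 1 := by
  have h := summable_geometric_two.tsum_eq_zero_add
  rw [tsum_geometric_two, pow_zero] at h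
  linarith

theorem sum_wt (s : ℕ → Fin 3) : ∑ k, wt k s = 1 := by
  unfold wt
  rw [← Summable.tsum_finsetSum fun k _ => summable_wt k s]
  refine Eq.trans ?_ tsum_half_pow_succ
  refine tsum_congr fun n => ?_
  rw [← Finset.mul_sum, Finset.sum_ite_eq Finset.univ (s n), if_pos (Finset.mem_univ _), mul_one]

theorem wt_cons (k i : Fin 3) (s : ℕ → Fin 3) :
    wt k (consSeq i s) = wt k s / 2 + if i = k then 1 / 2 else 0 := by
  unfold wt
  rw [(summable_wt k (consSeq i s)).tsum_eq_zero_add]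
  have : ∑' n, (1 / 2 : ℝ) ^ (n + 1 + 1) * (if consSeq i s (n + 1) = k then (1 : ℝ) else 0)
      = (∑' n, (1 / 2 : ℝ) ^ (n + 1) * if s n = k then (1 : ℝ) else 0) / 2 := by
    rw [← tsum_div_const]
    refine tsum_congr fun n => ?_
    rw [show consSeq i s (n + 1) = s n from rfl]
    ring
  rw [this, show consSeq i s 0 = i from rfl, add_comm]
  congr 1
  split_ifs <;> norm_num

theorem wt_const (k i : Fin 3) : wt k (fun _ => i) = if i = k then 1 else 0 := by
  unfold wt
  rw [tsum_mul_right, tsum_half_pow_succ, one_mul]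

theorem wt_perm (σ : Equiv.Perm (Fin 3)) (k : Fin 3) (s : ℕ → Fin 3) :
    wt k (fun n => σ (s n)) = wt (σ.symm k) s := by
  unfold wt
  refine tsum_congr fun n => ?_
  simp [Equiv.eq_symm_apply]

theorem code_eq_sum_wt (q : Fin 3 → Plane) (s : ℕ → Fin 3) : code q s = ∑ k, wt k s • q k := by
  unfold wt code
  simp_rw [← Summable.tsum_smul_const (summable_wt _ s)]
  rw [← Summable.tsum_finsetSum fun k _ => (summable_wt k s).smul_const (q k)]
  refine tsum_congr fun n => ?_
  simp

/-- The vector from the centroid to $q_k$ is normal to the opposite side. Pairing with three times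
this vector separates $q_k$ from the other two vertices by $\tfrac32a^2$, where $a$ is the side
length. Thus a point determines its barycentric coordinates, whichever of its addresses is used. -/
theorem exists_functional {q : Fin 3 → Plane} (hq : IsEquilateral q) (k : Fin 3) :
    ∃ (L : Plane →L[ℝ] ℝ) (c l : ℝ), l ≠ 0 ∧ ∀ i, L (q i) = c + l * if i = k then 1 else 0 := by
  obtain ⟨a, ha, h⟩ := hq
  have h2 : ∀ i j, i ≠ j → ‖q i‖ ^ 2 - 2 * inner ℝ (q i) (q j) + ‖q j‖ ^ 2 = a ^ 2 := by
    intro i j hij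
    rw [← h i j hij, dist_eq_norm, norm_sub_sq_real]
  have h01 := h2 0 1 (by decide)
  have h02 := h2 0 2 (by decide)
  have h12 := h2 1 2 (by decide)
  have c01 := real_inner_comm (q 0) (q 1)
  have c02 := real_inner_comm (q 0) (q 2)
  have c12 := real_inner_comm (q 1) (q 2)
  refine ⟨innerSL ℝ ((3 : ℝ) • q k - ∑ j, q j),
    inner ℝ ((3 : ℝ) • q k - ∑ j, q j) (q k) - 3 / 2 * a ^ 2, 3 / 2 * a ^ 2, by positivity, ?_⟩
  intro i
  simp only [innerSL_apply_apply, inner_sub_left, inner_smul_left, Fin.sum_univ_three,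
    inner_add_left, RCLike.conj_to_real]
  fin_cases k <;> fin_cases i <;> simp <;> linarith

theorem functional_code {q : Fin 3 → Plane} {L : Plane →L[ℝ] ℝ} {c l : ℝ} {k : Fin 3}
    (h : ∀ i, L (q i) = c + l * if i = k then 1 else 0) (s : ℕ → Fin 3) :
    L (code q s) = c + l * wt k s := by
  rw [code_eq_sum_wt, map_sum]
  simp only [map_smul, h, smul_eq_mul, mul_add, Finset.sum_add_distrib]
  rw [← Finset.sum_mul, sum_wt, one_mul]
  simp [mul_comm]

theorem wt_eq_of_code_eq {q : Fin 3 → Plane} (hq : IsEquilateral q) {s t : ℕ → Fin 3}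
    (h : code q s = code q t) (k : Fin 3) : wt k s = wt k t := by
  obtain ⟨L, c, l, hl, hL⟩ := exists_functional hq k
  have h1 := functional_code hL s
  rw [h, functional_code hL t] at h1
  exact mul_left_cancel₀ hl (by linarith)

/-! ### The gasket as a compact space, its cells and barycentric coordinates -/

section

variable (q : Fin 3 → Plane)

/-- The point of the gasket with address `s`. -/
noncomputable def pt (s : ℕ → Fin 3) : Gasket q := ⟨code q s, s, rfl⟩

variable {q}

theorem exists_pt (x : Gasket q) : ∃ s, x = pt q s := by
  obtain ⟨x, s, rfl⟩ := x
  exact ⟨s, rfl⟩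

theorem F_pt (i : Fin 3) (s : ℕ → Fin 3) : F q i (pt q s) = pt q (consSeq i s) :=
  Subtype.ext (contraction_code q i s)

theorem corner_eq_pt (i : Fin 3) : corner q i = pt q fun _ => i :=
  Subtype.ext (code_const q i).symm

theorem consSeq_const (i : Fin 3) : consSeq i (fun _ => i) = fun _ => i := by
  funext n
  cases n <;> rfl

theorem consSeq_head_tail (s : ℕ → Fin 3) : consSeq (s 0) (fun n => s (n + 1)) = s := by
  funext n
  cases n <;> rfl

theorem F_corner (i : Fin 3) : F q i (corner q i) = corner q i := by
  rw [corner_eq_pt, F_pt, consSeq_const]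

theorem exists_F (x : Gasket q) : ∃ i y, x = F q i y := by
  obtain ⟨s, rfl⟩ := exists_pt x
  exact ⟨s 0, pt q fun n => s (n + 1), by rw [F_pt, consSeq_head_tail]⟩

theorem continuous_pt : Continuous (pt q) := Continuous.subtype_mk (continuous_code q) _

instance : CompactSpace (Gasket q) := isCompact_iff_compactSpace.1 (gasket_isCompact q)

instance : Nonempty (Gasket q) := ⟨corner q 0⟩

/-- A continuous surjection from a compact space to a Hausdorff space; continuity on the gasket can
therefore be tested on addresses. -/
theorem isQuotientMap_pt : IsQuotientMap (pt q) :=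
  continuous_pt.isClosedMap.isQuotientMap continuous_pt
    fun x => (exists_pt x).imp fun _ h => h.symm

theorem dist_F (i : Fin 3) (x y : Gasket q) : dist (F q i x) (F q i y) = dist x y / 2 := by
  rw [Subtype.dist_eq, Subtype.dist_eq, dist_eq_norm, dist_eq_norm]
  simp only [F, contraction]
  rw [show (1 / 2 : ℝ) • ((x : Plane) - q i) + q i - ((1 / 2 : ℝ) • ((y : Plane) - q i) + q i)
    = (1 / 2 : ℝ) • ((x : Plane) - y) by module, norm_smul]
  norm_num
  ring

theorem F_injective (i : Fin 3) : Function.Injective (F q i) := by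
  intro x y h
  have := dist_F i x y
  rw [h, dist_self] at this
  exact dist_eq_zero.1 (by linarith)

theorem F_inj (i : Fin 3) {x y : Gasket q} : F q i x = F q i y ↔ x = y := (F_injective i).eq_iff

theorem continuous_F (i : Fin 3) : Continuous (F q i) := by
  refine (LipschitzWith.of_dist_le_mul (K := 1) fun x y => ?_).continuous
  rw [dist_F, NNReal.coe_one, one_mul]
  linarith [dist_nonneg (x := x) (y := y)]

/-- The `k`-th barycentric coordinate on the gasket. -/
noncomputable def bary (k : Fin 3) (x : Gasket q) : ℝ := wt k (exists_pt x).choose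

theorem bary_pt (hq : IsEquilateral q) (k : Fin 3) (s : ℕ → Fin 3) : bary k (pt q s) = wt k s :=
  wt_eq_of_code_eq hq (Subtype.ext_iff.1 (exists_pt (pt q s)).choose_spec).symm k

theorem bary_nonneg (k : Fin 3) (x : Gasket q) : 0 ≤ bary k x := wt_nonneg _ _

theorem sum_bary (x : Gasket q) : ∑ k, bary k x = 1 := sum_wt _

theorem bary_corner (hq : IsEquilateral q) (k i : Fin 3) :
    bary k (corner q i) = if i = k then 1 else 0 := by
  rw [corner_eq_pt, bary_pt hq, wt_const]

theorem bary_F (hq : IsEquilateral q) (k i : Fin 3) (x : Gasket q) :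
    bary k (F q i x) = bary k x / 2 + if i = k then 1 / 2 else 0 := by
  obtain ⟨s, rfl⟩ := exists_pt x
  rw [F_pt, bary_pt hq, bary_pt hq, wt_cons]

theorem eq_sum_bary (hq : IsEquilateral q) (x : Gasket q) : (x : Plane) = ∑ k, bary k x • q k := by
  obtain ⟨s, rfl⟩ := exists_pt x
  simp_rw [bary_pt hq]
  exact code_eq_sum_wt q s

theorem bary_ext (hq : IsEquilateral q) {x y : Gasket q} (h : ∀ k, bary k x = bary k y) :
    x = y := by
  apply Subtype.ext
  rw [eq_sum_bary hq x, eq_sum_bary hq y]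
  simp_rw [h]

theorem continuous_bary (hq : IsEquilateral q) (k : Fin 3) :
    Continuous (bary k : Gasket q → ℝ) := by
  rw [isQuotientMap_pt.continuous_iff]
  obtain ⟨L, c, l, hl, hL⟩ := exists_functional hq k
  have : bary k ∘ pt q = fun s => (L (code q s) - c) / l := by
    funext s
    rw [functional_code hL, Function.comp_apply, bary_pt hq]
    field_simp
    ring
  rw [this]
  exact ((L.continuous.comp (continuous_code q)).sub continuous_const).div_const _

theorem corner_injective (hq : IsEquilateral q) : Function.Injective (corner q) := by
  intro i j h
  have := bary_corner hq j i
  rw [h, bary_corner hq] at this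
  by_contra hij
  simp [hij] at this

theorem eq_corner_of_bary (hq : IsEquilateral q) {i : Fin 3} {x : Gasket q} (h : 1 ≤ bary i x) :
    x = corner q i := by
  apply bary_ext hq
  have hs := sum_bary x
  intro k
  rw [bary_corner hq]
  have h0 := bary_nonneg 0 x
  have h1 := bary_nonneg 1 x
  have h2 := bary_nonneg 2 x
  rw [Fin.sum_univ_three] at hs
  fin_cases i <;> fin_cases k <;> simp at h ⊢ <;> linarith

/-- Different cells of level one meet only in a junction point. -/
theorem right_eq_corner (hq : IsEquilateral q) {i j : Fin 3} (hij : i ≠ j) {x y : Gasket q}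
    (h : F q i x = F q j y) : y = corner q i := by
  -- On $F_i(SG)$ the $i$-th coordinate is at least $1/2$; on $F_j(SG)$ it is half that of $y$.
  -- Equality forces the $i$-th coordinate of $y$ to be $1$.
  have h1 := bary_F hq i i x
  rw [h, bary_F hq] at h1
  simp only [hij.symm, if_true, if_false] at h1
  exact eq_corner_of_bary hq (by linarith [bary_nonneg i x])

theorem F_corner_comm (hq : IsEquilateral q) (i j : Fin 3) :
    F q i (corner q j) = F q j (corner q i) := by
  apply bary_ext hq
  intro k
  rw [bary_F hq, bary_F hq, bary_corner hq, bary_corner hq]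
  split_ifs <;> norm_num

theorem F_eq_corner (hq : IsEquilateral q) {i j : Fin 3} {x : Gasket q}
    (h : F q i x = corner q j) : i = j ∧ x = corner q j := by
  have hij : i = j := by
    by_contra hij
    have h1 := right_eq_corner hq hij (h.trans (F_corner j).symm)
    exact hij (corner_injective hq h1).symm
  subst hij
  exact ⟨rfl, F_injective i (h.trans (F_corner i).symm)⟩

/-! ### Gluing functions along the cells of level one -/

/-- The function equal to `u i` on the cell `F_i(SG)`. -/
noncomputable def glue (u : Fin 3 → Gasket q → ℝ) (x : Gasket q) : ℝ :=
  u (exists_F x).choose (exists_F x).choose_spec.choose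

/-- The functions `u i ∘ F_i⁻¹` agree at the junction points. -/
def Compatible (u : Fin 3 → Gasket q → ℝ) : Prop :=
  ∀ i j, u i (corner q j) = u j (corner q i)

theorem Compatible.eq_of_F_eq (hq : IsEquilateral q) {u : Fin 3 → Gasket q → ℝ}
    (hu : Compatible u) {i j : Fin 3} {x y : Gasket q} (h : F q i x = F q j y) :
    u i x = u j y := by
  by_cases hij : i = j
  · subst hij
    rw [F_injective i h]
  · rw [right_eq_corner hq hij h, right_eq_corner hq (Ne.symm hij) h.symm, hu]

theorem glue_F (hq : IsEquilateral q) {u : Fin 3 → Gasket q → ℝ} (hu : Compatible u) (i : Fin 3)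
    (x : Gasket q) : glue u (F q i x) = u i x :=
  (hu.eq_of_F_eq hq (exists_F (F q i x)).choose_spec.choose_spec).symm

theorem continuous_of_comp_F {X : Type*} [TopologicalSpace X] {u : Gasket q → X}
    (h : ∀ i, Continuous (u ∘ F q i)) : Continuous u := by
  rw [continuous_iff_isClosed]
  intro C hC
  have : u ⁻¹' C = ⋃ i, F q i '' ((u ∘ F q i) ⁻¹' C) := by
    ext x
    simp only [Set.mem_iUnion, Set.mem_image, Set.mem_preimage, Function.comp_apply]
    constructor
    · intro hx
      obtain ⟨i, y, rfl⟩ := exists_F x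
      exact ⟨i, y, hx, rfl⟩
    · rintro ⟨i, y, hy, rfl⟩
      exact hy
  rw [this]
  exact isClosed_iUnion_of_finite fun i => (continuous_F i).isClosedMap _ (hC.preimage (h i))

theorem continuous_glue (hq : IsEquilateral q) {u : Fin 3 → Gasket q → ℝ} (hu : Compatible u)
    (hc : ∀ i, Continuous (u i)) : Continuous (glue u) :=
  continuous_of_comp_F fun i => by
    rw [show glue u ∘ F q i = u i from funext (glue_F hq hu i)]
    exact hc i

/-! ### The reflection fixing the zeroth corner -/

/-- The reflection of the gasket that fixes `q_0` and exchanges `q_1` and `q_2`. -/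
noncomputable def reflect (x : Gasket q) : Gasket q :=
  pt q fun n => Equiv.swap 1 2 ((exists_pt x).choose n)

/-- Exchanging letters permutes the barycentric coordinates, so the result does not depend on the
address chosen in the definition. -/
theorem reflect_pt (hq : IsEquilateral q) (s : ℕ → Fin 3) :
    reflect (pt q s) = pt q fun n => Equiv.swap 1 2 (s n) := by
  apply bary_ext hq
  intro k
  unfold reflect
  rw [bary_pt hq, bary_pt hq, wt_perm, wt_perm]
  exact bary_pt hq _ s

theorem reflect_F (hq : IsEquilateral q) (i : Fin 3) (x : Gasket q) :
    reflect (F q i x) = F q (Equiv.swap 1 2 i) (reflect x) := by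
  obtain ⟨s, rfl⟩ := exists_pt x
  rw [F_pt, reflect_pt hq, reflect_pt hq, F_pt]
  congr 1
  funext n
  cases n <;> rfl

theorem reflect_corner (hq : IsEquilateral q) (i : Fin 3) :
    reflect (corner q i) = corner q (Equiv.swap 1 2 i) := by
  rw [corner_eq_pt, reflect_pt hq, corner_eq_pt]

theorem reflect_reflect (hq : IsEquilateral q) (x : Gasket q) : reflect (reflect x) = x := by
  obtain ⟨s, rfl⟩ := exists_pt x
  rw [reflect_pt hq, reflect_pt hq]
  simp

theorem continuous_reflect (hq : IsEquilateral q) : Continuous (reflect : Gasket q → Gasket q) := by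
  rw [isQuotientMap_pt.continuous_iff]
  rw [show reflect ∘ pt q = pt q ∘ fun s n => Equiv.swap 1 2 (s n) from funext (reflect_pt hq)]
  refine continuous_pt.comp (continuous_pi fun n => ?_)
  exact (continuous_of_discreteTopology (f := Equiv.swap (1 : Fin 3) 2)).comp (continuous_apply n)

/-! ### Harmonic functions -/

/-- The values at the vertices of the cell `F_i(SG)` of the harmonic function with boundary
values `a`. -/
noncomputable def cellValues (i : Fin 3) (a : Fin 3 → ℝ) (j : Fin 3) : ℝ :=
  if i = j then a i else (a 0 + a 1 + a 2 + a i + a j) / 5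

theorem cellValues_comm (i j : Fin 3) (a : Fin 3 → ℝ) : cellValues i a j = cellValues j a i := by
  unfold cellValues
  by_cases h : i = j
  · subst h
    rfl
  · rw [if_neg h, if_neg (Ne.symm h)]
    ring

theorem cellValues_self (i : Fin 3) (a : Fin 3 → ℝ) : cellValues i a i = a i := if_pos rfl

theorem cellValues_add (i : Fin 3) (a b : Fin 3 → ℝ) :
    cellValues i (a + b) = cellValues i a + cellValues i b := by
  funext j
  simp only [cellValues, Pi.add_apply]
  split_ifs <;> ring

theorem cellValues_smul (i : Fin 3) (r : ℝ) (a : Fin 3 → ℝ) :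
    cellValues i (r • a) = r • cellValues i a := by
  funext j
  simp only [cellValues, Pi.smul_apply, smul_eq_mul]
  split_ifs <;> ring

theorem cellValues_one (i : Fin 3) : cellValues i 1 = 1 := by
  funext j
  simp only [cellValues, Pi.one_apply]
  split_ifs <;> norm_num

theorem cellValues_nonneg {a : Fin 3 → ℝ} (h : 0 ≤ a) (i : Fin 3) : 0 ≤ cellValues i a := by
  intro j
  have := h 0
  have := h 1
  have := h 2
  have := h i
  have := h j
  simp only [cellValues, Pi.zero_apply] at *
  split_ifs
  · assumption
  · positivity

/-- A junction value has weights $2/5$ at the two nearest vertices and $1/5$ at the third, so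
passing to a cell contracts the oscillation by $3/5$. This drives the uniform convergence of
`harmApprox`. -/
theorem cellValues_osc {a : Fin 3 → ℝ} {C : ℝ} (h : ∀ j k, |a j - a k| ≤ C) (i j k : Fin 3) :
    |cellValues i a j - cellValues i a k| ≤ 3 / 5 * C := by
  have h00 := abs_le.1 (h 0 0)
  have h01 := abs_le.1 (h 0 1)
  have h02 := abs_le.1 (h 0 2)
  have h12 := abs_le.1 (h 1 2)
  rw [sub_self] at h00
  rw [abs_le]
  fin_cases i <;> fin_cases j <;> fin_cases k <;> simp [cellValues] <;>
    first | linarith | (constructor <;> linarith)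

/-- Approximations of the harmonic function with boundary values `a`. -/
noncomputable def harmApprox : ℕ → (Fin 3 → ℝ) → Gasket q → ℝ
  | 0, a => fun x => ∑ k, a k * bary k x
  | n + 1, a => glue fun i => harmApprox n (cellValues i a)

theorem harmApprox_corner (hq : IsEquilateral q) (n : ℕ) (a : Fin 3 → ℝ) (i : Fin 3) :
    harmApprox n a (corner q i) = a i := by
  induction n generalizing a i with
  | zero => simp [harmApprox, bary_corner hq]
  | succ n ih =>
    rw [← F_corner i, harmApprox, glue_F hq, ih, cellValues_self]
    intro i j
    simp only [ih]
    exact cellValues_comm i j a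

theorem compatible_harmApprox (hq : IsEquilateral q) (n : ℕ) (a : Fin 3 → ℝ) :
    Compatible fun i => (harmApprox n (cellValues i a) : Gasket q → ℝ) := by
  intro i j
  simp only [harmApprox_corner hq]
  exact cellValues_comm i j a

theorem harmApprox_F (hq : IsEquilateral q) (n : ℕ) (a : Fin 3 → ℝ) (i : Fin 3) (x : Gasket q) :
    harmApprox (n + 1) a (F q i x) = harmApprox n (cellValues i a) x :=
  glue_F hq (compatible_harmApprox hq n a) i x

theorem continuous_harmApprox (hq : IsEquilateral q) (n : ℕ) (a : Fin 3 → ℝ) :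
    Continuous (harmApprox n a : Gasket q → ℝ) := by
  induction n generalizing a with
  | zero => exact continuous_finsetSum _ fun k _ => continuous_const.mul (continuous_bary hq k)
  | succ n ih => exact continuous_glue hq (compatible_harmApprox hq n a) fun i => ih _

theorem abs_harmApprox_zero_sub_le {a : Fin 3 → ℝ} {C : ℝ} (h : ∀ j k, |a j - a k| ≤ C)
    (x : Gasket q) (i : Fin 3) : |harmApprox 0 a x - a i| ≤ C := by
  have h1 : harmApprox 0 a x - a i = ∑ k, (a k - a i) * bary k x := by
    simp only [sub_mul, Finset.sum_sub_distrib, ← Finset.mul_sum, sum_bary, mul_one, harmApprox]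
  have h2 : C = ∑ k, C * bary k x := by rw [← Finset.mul_sum, sum_bary, mul_one]
  rw [h1, h2]
  refine (Finset.abs_sum_le_sum_abs _ _).trans (Finset.sum_le_sum fun k _ => ?_)
  rw [abs_mul, abs_of_nonneg (bary_nonneg k x)]
  exact mul_le_mul_of_nonneg_right (h k i) (bary_nonneg k x)

/-- On the cell $F_i(SG)$ the first two approximations differ from $a_i$ by at most $C$ and
$\tfrac35C$. Later steps repeat this inside smaller cells, where the oscillation has already shrunk.
-/
theorem dist_harmApprox_succ_le (hq : IsEquilateral q) (n : ℕ) {a : Fin 3 → ℝ} {C : ℝ}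
    (h : ∀ j k, |a j - a k| ≤ C) (x : Gasket q) :
    dist (harmApprox n a x) (harmApprox (n + 1) a x) ≤ 2 * C * (3 / 5) ^ n := by
  induction n generalizing a C x with
  | zero =>
    obtain ⟨i, y, rfl⟩ := exists_F x
    have hC : 0 ≤ C := (abs_nonneg _).trans (h 0 0)
    rw [harmApprox_F hq, Real.dist_eq]
    have h1 := abs_harmApprox_zero_sub_le h (F q i y) i
    have h2 := abs_harmApprox_zero_sub_le (cellValues_osc h i) y i
    rw [cellValues_self] at h2
    rw [abs_le] at *
    constructor <;> linarith [h1.1, h1.2, h2.1, h2.2]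
  | succ n ih =>
    obtain ⟨i, y, rfl⟩ := exists_F x
    rw [harmApprox_F hq, harmApprox_F hq]
    refine (ih (cellValues_osc h i) y).trans (le_of_eq ?_)
    ring

/-- A bound for the oscillation of `a`. -/
theorem exists_osc_bound (a : Fin 3 → ℝ) : ∃ C, ∀ j k, |a j - a k| ≤ C := by
  refine ⟨∑ j, ∑ k, |a j - a k|, fun j k => ?_⟩
  refine le_trans ?_ (Finset.single_le_sum (f := fun j => ∑ k, |a j - a k|)
    (fun j _ => Finset.sum_nonneg fun k _ => abs_nonneg _) (Finset.mem_univ j))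
  exact Finset.single_le_sum (f := fun k => |a j - a k|) (fun k _ => abs_nonneg _)
    (Finset.mem_univ k)

/-- The harmonic function with boundary values `a`. -/
noncomputable def harm (a : Fin 3 → ℝ) (x : Gasket q) : ℝ :=
  limUnder atTop fun n => harmApprox n a x

theorem tendsto_harmApprox (hq : IsEquilateral q) (a : Fin 3 → ℝ) (x : Gasket q) :
    Tendsto (fun n => harmApprox n a x) atTop (𝓝 (harm a x)) := by
  obtain ⟨C, hC⟩ := exists_osc_bound a
  exact (cauchySeq_of_le_geometric (3 / 5) (2 * C) (by norm_num)
    fun n => dist_harmApprox_succ_le hq n hC x).tendsto_limUnder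

theorem continuous_harm (hq : IsEquilateral q) (a : Fin 3 → ℝ) :
    Continuous (harm a : Gasket q → ℝ) := by
  obtain ⟨C, hC⟩ := exists_osc_bound a
  have hu : TendstoUniformly (fun n => (harmApprox n a : Gasket q → ℝ)) (harm a) atTop := by
    rw [Metric.tendstoUniformly_iff]
    intro ε hε
    have h1 : Tendsto (fun n : ℕ => 2 * C * (3 / 5) ^ n / (1 - 3 / 5)) atTop (𝓝 0) := by
      simpa using ((tendsto_pow_atTop_nhds_zero_of_lt_one (r := (3 / 5 : ℝ)) (by norm_num)
        (by norm_num)).const_mul (2 * C)).div_const (1 - 3 / 5)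
    filter_upwards [h1.eventually (gt_mem_nhds hε)] with n hn x
    rw [dist_comm]
    exact (dist_le_of_le_geometric_of_tendsto (3 / 5) (2 * C) (by norm_num)
      (fun n => dist_harmApprox_succ_le hq n hC x) (tendsto_harmApprox hq a x) n).trans_lt hn
  exact hu.continuous (Frequently.of_forall fun n => continuous_harmApprox hq n a)

theorem harm_corner (hq : IsEquilateral q) (a : Fin 3 → ℝ) (i : Fin 3) :
    harm a (corner q i) = a i := by
  refine tendsto_nhds_unique (tendsto_harmApprox hq a _) ?_
  simp only [harmApprox_corner hq]
  exact tendsto_const_nhds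

theorem harm_F (hq : IsEquilateral q) (a : Fin 3 → ℝ) (i : Fin 3) (x : Gasket q) :
    harm a (F q i x) = harm (cellValues i a) x := by
  refine tendsto_nhds_unique ((tendsto_harmApprox hq a _).comp (tendsto_add_atTop_nat 1)) ?_
  refine (tendsto_harmApprox hq _ x).congr fun n => ?_
  exact (harmApprox_F hq n a i x).symm

theorem harmApprox_add (hq : IsEquilateral q) (n : ℕ) (a b : Fin 3 → ℝ) (x : Gasket q) :
    harmApprox n (a + b) x = harmApprox n a x + harmApprox n b x := by
  induction n generalizing a b x with
  | zero => simp [harmApprox, add_mul, Finset.sum_add_distrib]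
  | succ n ih =>
    obtain ⟨i, y, rfl⟩ := exists_F x
    simp only [harmApprox_F hq, cellValues_add, ih]

theorem harmApprox_smul (hq : IsEquilateral q) (n : ℕ) (r : ℝ) (a : Fin 3 → ℝ) (x : Gasket q) :
    harmApprox n (r • a) x = r * harmApprox n a x := by
  induction n generalizing a x with
  | zero => simp [harmApprox, mul_assoc, Finset.mul_sum]
  | succ n ih =>
    obtain ⟨i, y, rfl⟩ := exists_F x
    simp only [harmApprox_F hq, cellValues_smul, ih]

theorem harmApprox_one (hq : IsEquilateral q) (n : ℕ) (x : Gasket q) : harmApprox n 1 x = 1 := by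
  induction n generalizing x with
  | zero => simp [harmApprox, sum_bary]
  | succ n ih =>
    obtain ⟨i, y, rfl⟩ := exists_F x
    rw [harmApprox_F hq, cellValues_one, ih]

theorem harmApprox_nonneg (hq : IsEquilateral q) (n : ℕ) {a : Fin 3 → ℝ} (h : 0 ≤ a)
    (x : Gasket q) : 0 ≤ harmApprox n a x := by
  induction n generalizing a x with
  | zero => exact Finset.sum_nonneg fun k _ => mul_nonneg (h k) (bary_nonneg k x)
  | succ n ih =>
    obtain ⟨i, y, rfl⟩ := exists_F x
    rw [harmApprox_F hq]
    exact ih (cellValues_nonneg h i) y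

theorem harm_add (hq : IsEquilateral q) (a b : Fin 3 → ℝ) (x : Gasket q) :
    harm (a + b) x = harm a x + harm b x :=
  tendsto_nhds_unique (tendsto_harmApprox hq _ x) <| by
    simp only [harmApprox_add hq]
    exact (tendsto_harmApprox hq a x).add (tendsto_harmApprox hq b x)

theorem harm_smul (hq : IsEquilateral q) (r : ℝ) (a : Fin 3 → ℝ) (x : Gasket q) :
    harm (r • a) x = r * harm a x :=
  tendsto_nhds_unique (tendsto_harmApprox hq _ x) <| by
    simp only [harmApprox_smul hq]
    exact (tendsto_harmApprox hq a x).const_mul r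

theorem harm_zero (hq : IsEquilateral q) (x : Gasket q) : harm 0 x = 0 := by
  simpa using harm_smul hq 0 0 x

theorem harm_sub (hq : IsEquilateral q) (a b : Fin 3 → ℝ) (x : Gasket q) :
    harm (a - b) x = harm a x - harm b x := by
  have := harm_add hq (a - b) b x
  rw [sub_add_cancel] at this
  linarith

theorem harm_one (hq : IsEquilateral q) (x : Gasket q) : harm 1 x = 1 :=
  tendsto_nhds_unique (tendsto_harmApprox hq _ x) <| by
    simp only [harmApprox_one hq]
    exact tendsto_const_nhds

theorem harm_nonneg (hq : IsEquilateral q) {a : Fin 3 → ℝ} (h : 0 ≤ a) (x : Gasket q) :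
    0 ≤ harm a x :=
  ge_of_tendsto' (tendsto_harmApprox hq a x) fun n => harmApprox_nonneg hq n h x

/-! ### Piecewise harmonic interpolation -/

/-- The function that is harmonic on the cells of level `m` and agrees with `φ` on `V_m`. -/
noncomputable def interp : ℕ → (Gasket q → ℝ) → Gasket q → ℝ
  | 0, φ => harm fun i => φ (corner q i)
  | m + 1, φ => glue fun i => interp m (φ ∘ F q i)

theorem interp_corner (hq : IsEquilateral q) (m : ℕ) (φ : Gasket q → ℝ) (i : Fin 3) :
    interp m φ (corner q i) = φ (corner q i) := by
  induction m generalizing φ i with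
  | zero => exact harm_corner hq _ i
  | succ m ih =>
    rw [← F_corner i, interp, glue_F hq, ih]
    · rfl
    intro i j
    simp only [ih, Function.comp_apply, F_corner_comm hq i j]

theorem compatible_interp (hq : IsEquilateral q) (m : ℕ) (φ : Gasket q → ℝ) :
    Compatible fun i => interp m (φ ∘ F q i) := by
  intro i j
  simp only [interp_corner hq, Function.comp_apply, F_corner_comm hq i j]

theorem interp_F (hq : IsEquilateral q) (m : ℕ) (φ : Gasket q → ℝ) (i : Fin 3) (x : Gasket q) :
    interp (m + 1) φ (F q i x) = interp m (φ ∘ F q i) x :=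
  glue_F hq (compatible_interp hq m φ) i x

theorem continuous_interp (hq : IsEquilateral q) (m : ℕ) (φ : Gasket q → ℝ) :
    Continuous (interp m φ) := by
  induction m generalizing φ with
  | zero => exact continuous_harm hq _
  | succ m ih => exact continuous_glue hq (compatible_interp hq m φ) fun i => ih _

theorem mem_V_zero {x : Gasket q} : x ∈ V q 0 ↔ ∃ i, x = corner q i := by
  simp [V, eq_comm]

theorem mem_V_succ {m : ℕ} {x : Gasket q} : x ∈ V q (m + 1) ↔ ∃ i, ∃ y ∈ V q m, x = F q i y := by
  simp [V, eq_comm]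

theorem corner_mem_V (m : ℕ) (i : Fin 3) : corner q i ∈ V q m := by
  induction m with
  | zero => exact mem_V_zero.2 ⟨i, rfl⟩
  | succ m ih => exact mem_V_succ.2 ⟨i, _, ih, (F_corner i).symm⟩

theorem V_subset_succ (m : ℕ) : V q m ⊆ V q (m + 1) := by
  induction m with
  | zero =>
    intro x hx
    obtain ⟨i, rfl⟩ := mem_V_zero.1 hx
    exact corner_mem_V 1 i
  | succ m ih =>
    intro x hx
    obtain ⟨i, y, hy, rfl⟩ := mem_V_succ.1 hx
    exact mem_V_succ.2 ⟨i, y, ih hy, rfl⟩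

theorem V_mono : Monotone (V q) := monotone_nat_of_le_succ V_subset_succ

theorem interp_of_mem_V (hq : IsEquilateral q) {m : ℕ} (φ : Gasket q → ℝ) {x : Gasket q}
    (hx : x ∈ V q m) : interp m φ x = φ x := by
  induction m generalizing φ x with
  | zero =>
    obtain ⟨i, rfl⟩ := mem_V_zero.1 hx
    exact interp_corner hq 0 φ i
  | succ m ih =>
    obtain ⟨i, y, hy, rfl⟩ := mem_V_succ.1 hx
    rw [interp_F hq, ih _ hy, Function.comp_apply]

theorem interp_nonneg (hq : IsEquilateral q) (m : ℕ) {φ : Gasket q → ℝ} (h : 0 ≤ φ)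
    (x : Gasket q) : 0 ≤ interp m φ x := by
  induction m generalizing φ x with
  | zero => exact harm_nonneg hq (fun i => h _) x
  | succ m ih =>
    obtain ⟨i, y, rfl⟩ := exists_F x
    rw [interp_F hq]
    exact ih (φ := φ ∘ F q i) (fun z => h (F q i z)) y

theorem interp_zero (hq : IsEquilateral q) (m : ℕ) (x : Gasket q) : interp m 0 x = 0 := by
  induction m generalizing x with
  | zero => exact harm_zero hq x
  | succ m ih =>
    obtain ⟨i, y, rfl⟩ := exists_F x
    rw [interp_F hq]
    exact ih y

/-! ### Indicators of points -/

open Classical in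
/-- The indicator of the point `x`. -/
noncomputable def delta (x y : Gasket q) : ℝ := if y = x then 1 else 0

theorem delta_nonneg (x : Gasket q) : 0 ≤ delta x := fun y => by
  unfold delta
  split_ifs <;> simp

theorem delta_of_ne {x y : Gasket q} (h : y ≠ x) : delta x y = 0 := if_neg h

theorem delta_F_comp (i : Fin 3) (x : Gasket q) : delta (F q i x) ∘ F q i = delta x := by
  funext y
  simp [delta, F_inj]

theorem delta_comp_of_forall_ne {x : Gasket q} {i : Fin 3} (h : ∀ y, x ≠ F q i y) :
    delta x ∘ F q i = 0 :=
  funext fun y => delta_of_ne (h y).symm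

theorem delta_F_comp_of_ne (hq : IsEquilateral q) {x : Gasket q} (hx : x ∉ V q 0) {i j : Fin 3}
    (hij : i ≠ j) : delta (F q i x) ∘ F q j = 0 :=
  delta_comp_of_forall_ne fun _ h =>
    hx (mem_V_zero.2 ⟨j, right_eq_corner hq hij.symm h.symm⟩)

theorem F_notMem_V_zero (hq : IsEquilateral q) {x : Gasket q} (hx : x ∉ V q 0) (i : Fin 3) :
    F q i x ∉ V q 0 := by
  intro h
  obtain ⟨j, hj⟩ := mem_V_zero.1 h
  exact hx (mem_V_zero.2 ⟨j, (F_eq_corner hq hj).2⟩)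

/-- The support of a tent is contained in the union of the cells that contain its top. -/
theorem interp_delta_eq_zero_of_dist_lt (hq : IsEquilateral q) {D : ℝ}
    (hD : ∀ x y : Gasket q, dist x y ≤ D) (m : ℕ) (x y : Gasket q)
    (h : D / 2 ^ m < dist x y) : interp m (delta x) y = 0 := by
  induction m generalizing x y with
  | zero =>
    rw [pow_zero, div_one] at h
    exact absurd (hD x y) (not_le.2 h)
  | succ m ih =>
    obtain ⟨i, y, rfl⟩ := exists_F y
    rw [interp_F hq]
    by_cases hx : ∃ x', x = F q i x'
    · obtain ⟨x', rfl⟩ := hx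
      rw [delta_F_comp]
      rw [dist_F, pow_succ, ← div_div] at h
      exact ih x' y (by linarith)
    · rw [delta_comp_of_forall_ne (not_exists.1 hx), interp_zero hq]

/-! ### Self-similarity of the measure -/

/-- The law of an address with independent, uniformly distributed letters. -/
noncomputable def addrMeasure : Measure (ℕ → Fin 3) :=
  Measure.infinitePi fun _ : ℕ => (PMF.uniformOfFintype (Fin 3)).toMeasure

instance : IsProbabilityMeasure addrMeasure :=
  inferInstanceAs (IsProbabilityMeasure (Measure.infinitePi _))

theorem continuous_consSeq : Continuous fun z : Fin 3 × (ℕ → Fin 3) => consSeq z.1 z.2 := by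
  refine continuous_pi fun n => ?_
  cases n with
  | zero => exact continuous_fst
  | succ n => exact (continuous_apply n).comp continuous_snd

/-- Prepending an independent uniform letter preserves the law of an address; it suffices to compare
the masses of cylinder sets. -/
theorem map_consSeq_addrMeasure :
    ((PMF.uniformOfFintype (Fin 3)).toMeasure.prod addrMeasure).map
      (fun z => consSeq z.1 z.2) = addrMeasure := by
  refine Measure.eq_infinitePi _ fun s t ht => ?_
  classical
  obtain ⟨N, hN⟩ := s.exists_nat_subset_range
  set ν := (PMF.uniformOfFintype (Fin 3)).toMeasure
  -- Padding with the trivial condition makes the index set an initial segment containing $0$, so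
  -- that the first letter splits off.
  let t' : ℕ → Set (Fin 3) := fun i => if i ∈ s then t i else Set.univ
  have hpi : (s : Set ℕ).pi t = (Finset.range (N + 1) : Set ℕ).pi t' := by
    ext x
    simp only [Set.mem_pi, Finset.mem_coe, t']
    constructor
    · intro h i _
      split_ifs with hi
      · exact h i hi
      · trivial
    · intro h i hi
      simpa [hi] using h i (Finset.mem_range.2 (Nat.lt_succ_of_lt (Finset.mem_range.1 (hN hi))))
  have hprod : ∏ i ∈ s, ν (t i) = ∏ i ∈ Finset.range (N + 1), ν (t' i) := by
    rw [← Finset.prod_subset (hN.trans (Finset.range_subset_range.2 N.le_succ))]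
    · exact Finset.prod_congr rfl fun i hi => by simp [t', hi]
    · intro i _ hi
      simp [t', hi]
  have hpre : (fun z : Fin 3 × (ℕ → Fin 3) => consSeq z.1 z.2) ⁻¹' ((s : Set ℕ).pi t)
      = t' 0 ×ˢ (Finset.range N : Set ℕ).pi fun i => t' (i + 1) := by
    rw [hpi]
    ext ⟨i, x⟩
    simp only [Set.mem_preimage, Set.mem_pi, Finset.mem_coe, Finset.mem_range, Set.mem_prod]
    constructor
    · exact fun h => ⟨h 0 N.succ_pos, fun k hk => h (k + 1) (Nat.succ_lt_succ hk)⟩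
    · rintro ⟨h0, h1⟩ k hk
      cases k with
      | zero => exact h0
      | succ k => exact h1 k (Nat.lt_of_succ_lt_succ hk)
  rw [Measure.map_apply continuous_consSeq.measurable
    (MeasurableSet.pi s.countable_toSet fun i _ => ht i), hpre, Measure.prod_prod, addrMeasure,
    Measure.infinitePi_pi _ fun i _ => Set.Finite.measurableSet (Set.toFinite _), hprod,
    Finset.prod_range_succ', mul_comm]

theorem integral_addrMeasure (g : (ℕ → Fin 3) → ℝ) (hg : Continuous g) :
    ∫ s, g s ∂addrMeasure = (∑ i, ∫ s, g (consSeq i s) ∂addrMeasure) / 3 := by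
  conv_lhs => rw [← map_consSeq_addrMeasure]
  rw [integral_map continuous_consSeq.measurable.aemeasurable
    hg.aestronglyMeasurable]
  rw [integral_prod, PMF.integral_eq_sum]
  · simp [div_eq_inv_mul, Finset.mul_sum]
  · exact ((hg.comp continuous_consSeq).integrable_of_hasCompactSupport
      (HasCompactSupport.of_compactSpace _))

theorem integrable_of_continuous {u : Gasket q → ℝ} (hu : Continuous u) : Integrable u (μ q) :=
  hu.integrable_of_hasCompactSupport (HasCompactSupport.of_compactSpace _)

theorem integral_eq_integral_addr {u : Gasket q → ℝ} (hu : Continuous u) :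
    ∫ x, u x ∂(μ q) = ∫ s, u (pt q s) ∂addrMeasure :=
  integral_map continuous_pt.measurable.aemeasurable hu.aestronglyMeasurable

/-- Self-similarity of the measure. -/
theorem integral_self_similar {u : Gasket q → ℝ} (hu : Continuous u) :
    ∫ x, u x ∂(μ q) = (∑ i, ∫ x, u (F q i x) ∂(μ q)) / 3 := by
  rw [integral_eq_integral_addr hu,
    integral_addrMeasure (fun s => u (pt q s)) (hu.comp continuous_pt)]
  congr 1
  refine Finset.sum_congr rfl fun i _ => ?_
  rw [integral_eq_integral_addr (u := fun x => u (F q i x)) (hu.comp (continuous_F i))]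
  simp only [F_pt]

/-- The mean of a harmonic function is the mean of its boundary values. -/
theorem integral_harm (hq : IsEquilateral q) (a : Fin 3 → ℝ) :
    ∫ x, harm a x ∂(μ q) = (∑ i, a i) / 3 := by
  let I : (Fin 3 → ℝ) →ₗ[ℝ] ℝ :=
    { toFun := fun a => ∫ x, harm a x ∂(μ q)
      map_add' := fun a b => by
        simp only [harm_add hq]
        exact integral_add (integrable_of_continuous (continuous_harm hq a))
          (integrable_of_continuous (continuous_harm hq b))
      map_smul' := fun r a => by
        simp only [harm_smul hq]
        exact integral_const_mul _ _ }
  have hI : ∀ a, I a = ∑ k, a k * I (Pi.single k 1) := fun a => by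
    have h : a = ∑ k, a k • (Pi.single k 1 : Fin 3 → ℝ) := by
      funext j
      simp [Finset.sum_apply, Pi.single_apply]
    conv_lhs => rw [h]
    rw [map_sum]
    simp only [map_smul, smul_eq_mul]
  have h1 : I 1 = 1 := by
    change ∫ x, harm 1 x ∂(μ q) = 1
    simp [harm_one hq]
  have hself : ∀ a, I a = (∑ i, I (cellValues i a)) / 3 := fun a => by
    change ∫ x, harm a x ∂(μ q) = _
    rw [integral_self_similar (continuous_harm hq a)]
    simp only [harm_F hq]
    rfl
  -- Self-similarity gives $3I_k=\tfrac95I_k+\tfrac35(I_l+I_n)$ with $\{k,l,n\}=\{0,1,2\}$. Together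
  -- with $I_0+I_1+I_2=1$ this forces $I_k=1/3$.
  have hk : ∀ k, I (Pi.single k 1) = 1 / 3 := by
    intro k
    have h2 := hself (Pi.single k 1)
    rw [hI] at h1
    simp only [hI (cellValues _ _)] at h2
    simp only [Fin.sum_univ_three, Pi.one_apply] at h1 h2
    fin_cases k <;> simp [cellValues] at h2 ⊢ <;> linarith
  change I a = _
  rw [hI, Finset.sum_div]
  exact Finset.sum_congr rfl fun k _ => by rw [hk]; ring

/-- For a nonnegative function, mean zero on the gasket passes to each cell, and a function takes
somewhere a value at most its mean. This expresses quantitatively that $\mu$ has full support. -/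
theorem exists_near_nonpos {D : ℝ} (hD : ∀ x y : Gasket q, dist x y ≤ D) (m : ℕ)
    {u : Gasket q → ℝ} (hu : Continuous u) (h0 : 0 ≤ u) (h : ∫ x, u x ∂(μ q) = 0) (x : Gasket q) :
    ∃ y, dist x y ≤ D / 2 ^ m ∧ u y ≤ 0 := by
  induction m generalizing u x with
  | zero =>
    obtain ⟨y, hy⟩ := exists_le_integral (integrable_of_continuous hu)
    exact ⟨y, by simpa using hD x y, hy.trans h.le⟩
  | succ m ih =>
    obtain ⟨i, x, rfl⟩ := exists_F x
    have hi : ∀ j, 0 ≤ ∫ x, u (F q j x) ∂(μ q) := fun j => integral_nonneg fun x => h0 (F q j x)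
    have h1 : ∫ x, u (F q i x) ∂(μ q) = 0 := by
      rw [integral_self_similar hu, div_eq_zero_iff] at h
      exact (Finset.sum_eq_zero_iff_of_nonneg fun j _ => hi j).1 (h.resolve_right (by norm_num)) i
        (Finset.mem_univ i)
    obtain ⟨y, hy, hy0⟩ := ih (u := u ∘ F q i) (hu.comp (continuous_F i)) (fun z => h0 (F q i z)) h1 x
    refine ⟨F q i y, ?_, hy0⟩
    rw [dist_F, pow_succ, ← div_div]
    linarith

theorem exists_dist_bound : ∃ D, ∀ x y : Gasket q, dist x y ≤ D :=
  ⟨Metric.diam (Set.univ : Set (Gasket q)), fun x y =>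
    Metric.dist_le_diam_of_mem isCompact_univ.isBounded (Set.mem_univ x) (Set.mem_univ y)⟩

theorem tendsto_div_two_pow (D : ℝ) : Tendsto (fun m : ℕ => D / 2 ^ m) atTop (𝓝 0) :=
  tendsto_const_nhds.div_atTop (tendsto_pow_atTop_atTop_of_one_lt one_lt_two)

/-- A nonnegative continuous function with integral zero vanishes. -/
theorem eq_zero_of_integral_eq_zero {u : Gasket q → ℝ} (hu : Continuous u) (h0 : 0 ≤ u)
    (h : ∫ x, u x ∂(μ q) = 0) : u = 0 := by
  obtain ⟨D, hD⟩ := exists_dist_bound (q := q)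
  funext x
  refine le_antisymm ?_ (h0 x)
  choose y hy hy0 using fun m => exists_near_nonpos hD m hu h0 h x
  have hlim : Tendsto y atTop (𝓝 x) := by
    rw [tendsto_iff_dist_tendsto_zero]
    refine squeeze_zero (fun m => dist_nonneg) (fun m => ?_) (tendsto_div_two_pow D)
    rw [dist_comm]
    exact hy m
  exact le_of_tendsto' ((hu.tendsto x).comp hlim) hy0

/-! ### Graph energies -/

/-- The bilinear energy form of a triangle. -/
noncomputable def triEnergy (a b : Fin 3 → ℝ) : ℝ :=
  (a 0 - a 1) * (b 0 - b 1) + (a 0 - a 2) * (b 0 - b 2) + (a 1 - a 2) * (b 1 - b 2)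

/-- The energy form of the graph `Γ_m`: the sum of the energies of all cells of level `m`. -/
noncomputable def energy : ℕ → (Gasket q → ℝ) → (Gasket q → ℝ) → ℝ
  | 0, u, φ => triEnergy (fun i => u (corner q i)) fun i => φ (corner q i)
  | m + 1, u, φ => ∑ i, energy m (u ∘ F q i) (φ ∘ F q i)

theorem energy_zero_right (m : ℕ) (u : Gasket q → ℝ) : energy m u 0 = 0 := by
  induction m generalizing u with
  | zero => simp [energy, triEnergy]
  | succ m ih => exact Finset.sum_eq_zero fun i _ => ih _

theorem energy_add_left (m : ℕ) (u v φ : Gasket q → ℝ) :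
    energy m (fun x => u x + v x) φ = energy m u φ + energy m v φ := by
  induction m generalizing u v φ with
  | zero => simp only [energy, triEnergy]; ring
  | succ m ih =>
    simp only [energy, ← Finset.sum_add_distrib]
    exact Finset.sum_congr rfl fun i _ => ih _ _ _

theorem energy_mul_left (m : ℕ) (r : ℝ) (u φ : Gasket q → ℝ) :
    energy m (fun x => r * u x) φ = r * energy m u φ := by
  induction m generalizing u φ with
  | zero => simp only [energy, triEnergy]; ring
  | succ m ih =>
    simp only [energy, Finset.mul_sum]
    exact Finset.sum_congr rfl fun i _ => ih _ _

/-- A harmonic function has the same renormalized energy on all levels. -/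
theorem energy_harm (hq : IsEquilateral q) (m : ℕ) (a : Fin 3 → ℝ) (φ : Gasket q → ℝ) :
    (5 / 3) ^ m * energy m (harm a) φ = triEnergy a fun i => φ (corner q i) := by
  induction m generalizing a φ with
  | zero => simp [energy, harm_corner hq]
  | succ m ih =>
    have h : ∀ i, harm a ∘ F q i = harm (cellValues i a) := fun i => funext (harm_F hq a i)
    simp only [energy, h]
    rw [pow_succ', mul_assoc, Finset.mul_sum]
    simp only [ih]
    simp only [Fin.sum_univ_three, Function.comp_apply, F_corner, triEnergy,
      F_corner_comm hq 1 0, F_corner_comm hq 2 0, F_corner_comm hq 2 1]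
    simp [cellValues]
    ring

/-! ### Adjacency, and the graph Laplacian as an energy -/

theorem adj_zero {x y : Gasket q} :
    Adj q 0 x y ↔ x ≠ y ∧ ∃ i j, x = corner q i ∧ y = corner q j := by
  simp [Adj, Fw]

theorem adj_succ {m : ℕ} {x y : Gasket q} :
    Adj q (m + 1) x y ↔ ∃ i x' y', x = F q i x' ∧ y = F q i y' ∧ Adj q m x' y' := by
  constructor
  · rintro ⟨hne, w, hw, j, k, rfl, rfl⟩
    obtain ⟨i, w, rfl⟩ := List.exists_cons_of_length_eq_add_one hw
    exact ⟨i, _, _, rfl, rfl, fun h => hne (congrArg (F q i) h), w,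
      by simpa using hw, j, k, rfl, rfl⟩
  · rintro ⟨i, x', y', rfl, rfl, hne, w, hw, j, k, rfl, rfl⟩
    exact ⟨fun h => hne (F_injective i h), i :: w, by simp [hw], j, k, rfl, rfl⟩

theorem Adj.symm {m : ℕ} {x y : Gasket q} (h : Adj q m x y) : Adj q m y x := by
  obtain ⟨hne, w, hw, i, j, hx, hy⟩ := h
  exact ⟨hne.symm, w, hw, j, i, hy, hx⟩

theorem adj_F (hq : IsEquilateral q) {m : ℕ} {i : Fin 3} {x y : Gasket q} (hx : x ∉ V q 0) :
    Adj q (m + 1) (F q i x) (F q i y) ↔ Adj q m x y := by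
  rw [adj_succ]
  constructor
  · rintro ⟨j, x', y', hx', hy', h⟩
    have hij : i = j := by
      by_contra hij
      exact hx (mem_V_zero.2 ⟨j, right_eq_corner hq (Ne.symm hij) hx'.symm⟩)
    subst hij
    rwa [F_injective i hx', F_injective i hy']
  · exact fun h => ⟨i, x, y, rfl, rfl, h⟩

/-- In the energy against the indicator of $x$ only the edges at $x$ contribute, each once, since no
edge belongs to two cells of level $m$. The right-hand side is additive over cells, which is what
the inductions need. -/
theorem graphLaplacian_eq_neg_energy (hq : IsEquilateral q) (m : ℕ) (u : Gasket q → ℝ)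
    (x : Gasket q) : graphLaplacian q m u x = -energy m u (delta x) := by
  classical
  induction m generalizing u x with
  | zero =>
    unfold graphLaplacian
    by_cases hx : ∃ i, x = corner q i
    · obtain ⟨i, rfl⟩ := hx
      have hfil : (V q 0).filter (Adj q 0 (corner q i))
          = (Finset.univ.filter (i ≠ ·)).image (corner q) := by
        ext y
        simp only [Finset.mem_filter, mem_V_zero, adj_zero, Finset.mem_image, Finset.mem_univ,
          true_and]
        constructor
        · rintro ⟨⟨j, rfl⟩, hne, -⟩
          exact ⟨j, fun h => hne (congrArg _ h), rfl⟩
        · rintro ⟨j, hij, rfl⟩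
          exact ⟨⟨j, rfl⟩, fun h => hij (corner_injective hq h), i, j, rfl, rfl⟩
      have hd : ∀ j, delta (corner q i) (corner q j) = if j = i then 1 else 0 := fun j => by
        simp [delta, (corner_injective hq).eq_iff]
      rw [hfil, Finset.sum_image fun a _ b _ h => corner_injective hq h, Finset.sum_filter]
      simp only [energy, triEnergy, hd, Fin.sum_univ_three]
      fin_cases i <;> simp <;> ring
    · have hfil : (V q 0).filter (Adj q 0 x) = ∅ := by
        ext y
        simp only [Finset.mem_filter, adj_zero, Finset.notMem_empty, iff_false]
        rintro ⟨-, -, i, -, h, -⟩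
        exact hx ⟨i, h⟩
      have hd : ∀ j, delta x (corner q j) = 0 := fun j => delta_of_ne fun h => hx ⟨j, h.symm⟩
      simp [hfil, energy, triEnergy, hd]
  | succ m ih =>
    unfold graphLaplacian
    have hfil : (V q (m + 1)).filter (Adj q (m + 1) x) = Finset.univ.biUnion fun i =>
        ((V q m).filter fun y => ∃ x', x = F q i x' ∧ Adj q m x' y).image (F q i) := by
      ext y
      simp only [Finset.mem_filter, mem_V_succ, adj_succ, Finset.mem_biUnion, Finset.mem_univ,
        true_and, Finset.mem_image]
      constructor
      · rintro ⟨⟨j, y₁, hy₁, rfl⟩, i, x', y', rfl, hy', h⟩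
        refine ⟨i, y', ⟨?_, x', rfl, h⟩, hy'.symm⟩
        by_cases hij : j = i
        · subst hij
          rwa [← F_injective j hy']
        · rw [right_eq_corner hq hij hy']
          exact corner_mem_V m j
      · rintro ⟨i, y, ⟨hy, x', rfl, h⟩, rfl⟩
        exact ⟨⟨i, y, hy, rfl⟩, i, x', y, rfl, rfl, h⟩
    -- An edge common to two cells of level one would have both endpoints at their single junction
    -- point.
    have hdis : ((Finset.univ : Finset (Fin 3)) : Set (Fin 3)).PairwiseDisjoint fun i =>
        ((V q m).filter fun y => ∃ x', x = F q i x' ∧ Adj q m x' y).image (F q i) := by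
      intro i _ j _ hij
      refine Finset.disjoint_left.2 fun y hy hy' => ?_
      simp only [Finset.mem_image, Finset.mem_filter] at hy hy'
      obtain ⟨y, ⟨-, x', rfl, h⟩, rfl⟩ := hy
      obtain ⟨y₁, ⟨-, x₁, hx, h₁⟩, hy⟩ := hy'
      refine h₁.1 ?_
      rw [right_eq_corner hq hij hx, right_eq_corner hq hij hy.symm]
    rw [hfil, Finset.sum_biUnion hdis, energy, ← Finset.sum_neg_distrib]
    refine Finset.sum_congr rfl fun i _ => ?_
    rw [Finset.sum_image fun a _ b _ h => F_injective i h]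
    by_cases hx : ∃ x', x = F q i x'
    · obtain ⟨x', rfl⟩ := hx
      rw [delta_F_comp, ← ih]
      unfold graphLaplacian
      simp only [F_inj, exists_eq_left', Function.comp_apply]
    · rw [delta_comp_of_forall_ne (not_exists.1 hx), energy_zero_right, neg_zero]
      refine Finset.sum_eq_zero fun y hy => ?_
      obtain ⟨x', h, -⟩ := (Finset.mem_filter.1 hy).2
      exact absurd ⟨x', h⟩ hx

/-! ### Scaling and linearity of the Laplacian; harmonic functions -/

theorem graphLaplacian_comp_F (hq : IsEquilateral q) (m : ℕ) (u : Gasket q → ℝ) (i : Fin 3)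
    {x : Gasket q} (hx : x ∉ V q 0) :
    graphLaplacian q m (u ∘ F q i) x = graphLaplacian q (m + 1) u (F q i x) := by
  rw [graphLaplacian_eq_neg_energy hq, graphLaplacian_eq_neg_energy hq, energy,
    Finset.sum_eq_single i, delta_F_comp]
  · intro j _ hj
    rw [delta_F_comp_of_ne hq hx hj.symm, energy_zero_right]
  · simp

theorem F_mem_V_succ (hq : IsEquilateral q) {m : ℕ} {i : Fin 3} {x : Gasket q} :
    F q i x ∈ V q (m + 1) ↔ x ∈ V q m := by
  rw [mem_V_succ]
  constructor
  · rintro ⟨j, y, hy, h⟩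
    by_cases hij : i = j
    · subst hij
      rwa [F_injective i h]
    · rw [right_eq_corner hq (Ne.symm hij) h.symm]
      exact corner_mem_V m j
  · exact fun h => ⟨i, x, h, rfl⟩

/-- Level $m$ for $u\circ F_i$ is level $m+1$ for $u$; the factor $1/5$ is the quotient of the
renormalizations $5^m$ and $5^{m+1}$. -/
theorem hasLaplacian_comp_F (hq : IsEquilateral q) {u f : Gasket q → ℝ} (h : HasLaplacian q u f)
    (i : Fin 3) : HasLaplacian q (u ∘ F q i) fun x => 1 / 5 * f (F q i x) := by
  obtain ⟨hu, hf, hlim⟩ := h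
  refine ⟨hu.comp (continuous_F i), continuous_const.mul (hf.comp (continuous_F i)),
    fun ε hε => ?_⟩
  obtain ⟨M, hM⟩ := hlim (5 * ε) (by positivity)
  refine ⟨M, fun m hm x hx hx0 => ?_⟩
  have h1 := hM (m + 1) (by omega) (F q i x) ((F_mem_V_succ hq).2 hx) (F_notMem_V_zero hq hx0 i)
  rw [graphLaplacian_comp_F hq m u i hx0]
  rw [show 3 / 2 * 5 ^ m * graphLaplacian q (m + 1) u (F q i x) - 1 / 5 * f (F q i x)
    = 1 / 5 * (3 / 2 * 5 ^ (m + 1) * graphLaplacian q (m + 1) u (F q i x) - f (F q i x)) by ring,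
    abs_mul, abs_of_pos (by norm_num)]
  linarith

theorem graphLaplacian_add (m : ℕ) (u v : Gasket q → ℝ) (x : Gasket q) :
    graphLaplacian q m (u + v) x = graphLaplacian q m u x + graphLaplacian q m v x := by
  simp only [graphLaplacian, ← Finset.sum_add_distrib, Pi.add_apply]
  exact Finset.sum_congr rfl fun y _ => by ring

theorem graphLaplacian_smul (m : ℕ) (r : ℝ) (u : Gasket q → ℝ) (x : Gasket q) :
    graphLaplacian q m (r • u) x = r * graphLaplacian q m u x := by
  simp only [graphLaplacian, Finset.mul_sum, Pi.smul_apply, smul_eq_mul]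
  exact Finset.sum_congr rfl fun y _ => by ring

theorem HasLaplacian.add {u v f g : Gasket q → ℝ} (h : HasLaplacian q u f)
    (h' : HasLaplacian q v g) : HasLaplacian q (u + v) (f + g) := by
  refine ⟨h.1.add h'.1, h.2.1.add h'.2.1, fun ε hε => ?_⟩
  obtain ⟨M, hM⟩ := h.2.2 (ε / 2) (by positivity)
  obtain ⟨M', hM'⟩ := h'.2.2 (ε / 2) (by positivity)
  refine ⟨max M M', fun m hm x hx hx0 => ?_⟩
  have h1 := hM m (le_of_max_le_left hm) x hx hx0
  have h2 := hM' m (le_of_max_le_right hm) x hx hx0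
  rw [graphLaplacian_add, Pi.add_apply]
  rw [abs_lt] at *
  constructor <;> linarith [h1.1, h1.2, h2.1, h2.2]

theorem HasLaplacian.smul {u f : Gasket q → ℝ} (h : HasLaplacian q u f) (r : ℝ) :
    HasLaplacian q (r • u) (r • f) := by
  refine ⟨h.1.const_smul r, h.2.1.const_smul r, fun ε hε => ?_⟩
  obtain ⟨M, hM⟩ := h.2.2 (ε / (|r| + 1)) (by positivity)
  refine ⟨M, fun m hm x hx hx0 => ?_⟩
  have h1 := hM m hm x hx hx0
  rw [graphLaplacian_smul, Pi.smul_apply, smul_eq_mul,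
    show 3 / 2 * 5 ^ m * (r * graphLaplacian q m u x) - r * f x
      = r * (3 / 2 * 5 ^ m * graphLaplacian q m u x - f x) by ring, abs_mul]
  rw [lt_div_iff₀ (by positivity)] at h1
  nlinarith [abs_nonneg (3 / 2 * 5 ^ m * graphLaplacian q m u x - f x)]

theorem HasLaplacian.sub {u v f g : Gasket q → ℝ} (h : HasLaplacian q u f)
    (h' : HasLaplacian q v g) : HasLaplacian q (u - v) (f - g) := by
  have := h.add (h'.smul (-1))
  rwa [neg_one_smul, neg_one_smul, ← sub_eq_add_neg, ← sub_eq_add_neg] at this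

/-- The energy of a harmonic function against $\varphi$ depends only on $\varphi|_{V_0}$, so it
vanishes against the indicator of an interior vertex. The graph Laplacians are therefore exactly
zero at every level. -/
theorem hasLaplacian_harm (hq : IsEquilateral q) (a : Fin 3 → ℝ) :
    HasLaplacian q (harm a) 0 := by
  refine ⟨continuous_harm hq a, continuous_const, fun ε hε => ⟨0, fun m _ x _ hx0 => ?_⟩⟩
  have h := energy_harm hq m a (delta x)
  have hd : (fun i => delta x (corner q i)) = 0 :=
    funext fun i => delta_of_ne fun h => hx0 (mem_V_zero.2 ⟨i, h.symm⟩)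
  have h0 : energy m (harm a) (delta x) = 0 := by
    rw [hd] at h
    simpa [triEnergy] using h
  rw [graphLaplacian_eq_neg_energy hq, h0]
  simpa using hε

/-! ### Uniqueness -/

/-- A function with positive graph Laplacian takes its maximum over `V_m` on the boundary. -/
theorem le_of_graphLaplacian_pos {m : ℕ} {u : Gasket q → ℝ} {C : ℝ}
    (hpos : ∀ x ∈ V q m, x ∉ V q 0 → 0 < graphLaplacian q m u x)
    (hC : ∀ i, u (corner q i) ≤ C) {x : Gasket q} (hx : x ∈ V q m) : u x ≤ C := by
  classical
  obtain ⟨z, hz, hmax⟩ := (V q m).exists_max_image u ⟨x, hx⟩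
  refine (hmax x hx).trans ?_
  by_cases hz0 : z ∈ V q 0
  · obtain ⟨i, rfl⟩ := mem_V_zero.1 hz0
    exact hC i
  · refine absurd (hpos z hz hz0) (not_lt.2 (Finset.sum_nonpos fun y hy => ?_))
    linarith [hmax y (Finset.mem_of_mem_filter y hy)]

/-- Interior vertices are dense. The index is $m+1$ because $V_0$ has no interior vertex. -/
theorem exists_mem_V_dist_le {D : ℝ} (hD : ∀ x y : Gasket q, dist x y ≤ D) (hq : IsEquilateral q)
    (m : ℕ) (x : Gasket q) : ∃ y ∈ V q (m + 1), y ∉ V q 0 ∧ dist x y ≤ D / 2 ^ m := by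
  induction m generalizing x with
  | zero =>
    refine ⟨F q 0 (corner q 1), mem_V_succ.2 ⟨0, _, corner_mem_V 0 1, rfl⟩, fun h => ?_,
      by simpa using hD x _⟩
    obtain ⟨j, hj⟩ := mem_V_zero.1 h
    obtain ⟨h0, h1⟩ := F_eq_corner hq hj
    have := corner_injective hq h1
    rw [← h0] at this
    exact absurd this (by decide)
  | succ m ih =>
    obtain ⟨i, x, rfl⟩ := exists_F x
    obtain ⟨y, hy, hy0, hd⟩ := ih x
    refine ⟨F q i y, mem_V_succ.2 ⟨i, y, hy, rfl⟩, F_notMem_V_zero hq hy0 i, ?_⟩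
    rw [dist_F, pow_succ, ← div_div]
    linarith

/-- An upper bound that holds at all interior vertices holds everywhere. -/
theorem forall_of_forall_V (hq : IsEquilateral q) {u : Gasket q → ℝ} (hu : Continuous u) {C : ℝ}
    (h : ∀ m, ∀ x ∈ V q m, x ∉ V q 0 → u x ≤ C) (x : Gasket q) : u x ≤ C := by
  obtain ⟨D, hD⟩ := exists_dist_bound (q := q)
  choose y hy hy0 hd using fun m => exists_mem_V_dist_le hD hq m x
  have hlim : Tendsto y atTop (𝓝 x) := by
    rw [tendsto_iff_dist_tendsto_zero]
    refine squeeze_zero (fun m => dist_nonneg) (fun m => ?_) (tendsto_div_two_pow D)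
    rw [dist_comm]
    exact hd m
  exact le_of_tendsto' ((hu.tendsto x).comp hlim) fun m => h _ _ (hy m) (hy0 m)

theorem HasLaplacian.unique (hq : IsEquilateral q) {u f g : Gasket q → ℝ}
    (hf : HasLaplacian q u f) (hg : HasLaplacian q u g) : f = g := by
  have key : ∀ f g : Gasket q → ℝ, HasLaplacian q u f → HasLaplacian q u g → ∀ x, f x - g x ≤ 0 :=
    fun f g hf hg => forall_of_forall_V hq (hf.2.1.sub hg.2.1) fun m x hx hx0 => by
      refine le_of_forall_pos_le_add fun ε hε => ?_
      obtain ⟨M, hM⟩ := hf.2.2 (ε / 2) (by positivity)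
      obtain ⟨M', hM'⟩ := hg.2.2 (ε / 2) (by positivity)
      have hx' : x ∈ V q (max m (max M M')) := V_mono (le_max_left _ _) hx
      have h1 := abs_lt.1 (hM _ ((le_max_left _ _).trans (le_max_right _ _)) x hx' hx0)
      have h2 := abs_lt.1 (hM' _ ((le_max_right _ _).trans (le_max_right _ _)) x hx' hx0)
      rw [Pi.sub_apply]
      linarith [h1.1, h1.2, h2.1, h2.2]
  funext x
  exact le_antisymm (sub_nonpos.1 (key f g hf hg x)) (sub_nonpos.1 (key g f hg hf x))

/-! ### Green's function -/

theorem F_corner_eq_iff (hq : IsEquilateral q) {i j k l : Fin 3} :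
    F q i (corner q j) = F q k (corner q l) ↔ i = k ∧ j = l ∨ i = l ∧ j = k := by
  constructor
  · intro h
    by_cases hik : i = k
    · subst hik
      exact Or.inl ⟨rfl, corner_injective hq (F_injective i h)⟩
    · exact Or.inr ⟨(corner_injective hq (right_eq_corner hq hik h)).symm,
        corner_injective hq (right_eq_corner hq (Ne.symm hik) h.symm)⟩
  · rintro (⟨rfl, rfl⟩ | ⟨rfl, rfl⟩)
    · rfl
    · exact F_corner_comm hq i j

/-- The junction point opposite to `q_k`. -/
noncomputable def mid (k : Fin 3) : Gasket q := F q (k + 1) (corner q (k + 2))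

theorem mid_injective (hq : IsEquilateral q) : Function.Injective (mid : Fin 3 → Gasket q) := by
  intro k l h
  have key : ∀ k l : Fin 3, k + 1 = l + 1 ∧ k + 2 = l + 2 ∨ k + 1 = l + 2 ∧ k + 2 = l + 1 →
      k = l := by decide
  exact key k l ((F_corner_eq_iff hq).1 h)

open Classical in
theorem V_one_sdiff (hq : IsEquilateral q) : V q 1 \ V q 0 = Finset.univ.image mid := by
  ext x
  simp only [Finset.mem_sdiff, mem_V_succ, Finset.mem_image, Finset.mem_univ, true_and]
  constructor
  · rintro ⟨⟨i, y, hy, rfl⟩, h0⟩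
    obtain ⟨j, rfl⟩ := mem_V_zero.1 hy
    have hij : i ≠ j := by
      rintro rfl
      exact h0 (mem_V_zero.2 ⟨i, F_corner i⟩)
    have key : ∀ i j : Fin 3, i ≠ j → ∃ k, k + 1 = i ∧ k + 2 = j ∨ k + 1 = j ∧ k + 2 = i := by
      decide
    obtain ⟨k, hk⟩ := key i j hij
    exact ⟨k, (F_corner_eq_iff hq).2 hk⟩
  · rintro ⟨k, rfl⟩
    refine ⟨⟨k + 1, corner q (k + 2), corner_mem_V 0 _, rfl⟩, fun h => ?_⟩
    obtain ⟨j, hj⟩ := mem_V_zero.1 h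
    obtain ⟨h1, h2⟩ := F_eq_corner hq hj
    have key : ∀ k : Fin 3, k + 1 ≠ k + 2 := by decide
    exact key k (h1.trans (corner_injective hq h2).symm)

theorem notMem_V_zero_of_sdiff {m : ℕ} {z : Gasket q} (h : z ∉ V q m) : z ∉ V q 0 :=
  fun h0 => h (V_mono (Nat.zero_le m) h0)

open Classical in
-- The new vertices are the images under the $F_i$ of those one level lower. The images are
-- disjoint: a common point would come from a corner, which is not a new vertex.
theorem sum_V_sdiff_succ (hq : IsEquilateral q) (m : ℕ) (H : Gasket q → ℝ) :
    ∑ z ∈ V q (m + 2) \ V q (m + 1), H z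
      = ∑ i, ∑ z ∈ V q (m + 1) \ V q m, H (F q i z) := by
  have hV : V q (m + 2) \ V q (m + 1)
      = Finset.univ.biUnion fun i => (V q (m + 1) \ V q m).image (F q i) := by
    ext x
    simp only [Finset.mem_sdiff, Finset.mem_biUnion, Finset.mem_univ, true_and, Finset.mem_image]
    constructor
    · rintro ⟨h, h'⟩
      obtain ⟨i, y, hy, rfl⟩ := mem_V_succ.1 h
      exact ⟨i, y, ⟨hy, fun hy' => h' ((F_mem_V_succ hq).2 hy')⟩, rfl⟩
    · rintro ⟨i, y, ⟨hy, hy'⟩, rfl⟩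
      exact ⟨(F_mem_V_succ hq).2 hy, fun h => hy' ((F_mem_V_succ hq).1 h)⟩
  rw [hV, Finset.sum_biUnion]
  · exact Finset.sum_congr rfl fun i _ => Finset.sum_image fun a _ b _ h => F_injective i h
  · intro i _ j _ hij
    refine Finset.disjoint_left.2 fun y hy hy' => ?_
    simp only [Finset.mem_image, Finset.mem_sdiff] at hy hy'
    obtain ⟨y, -, rfl⟩ := hy
    obtain ⟨y', ⟨-, h⟩, h'⟩ := hy'
    refine h ?_
    rw [right_eq_corner hq hij h'.symm]
    exact corner_mem_V _ _

open Classical in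
/-- The contribution of the vertices of `V_{m+1} \ V_m` to Green's function. -/
noncomputable def greenLevel (m : ℕ) (x y : Gasket q) : ℝ :=
  ∑ z ∈ V q (m + 1) \ V q m, ∑ z' ∈ V q (m + 1) \ V q m,
    greenCoeff q m z z' * interp (m + 1) (delta z) x * interp (m + 1) (delta z') y

theorem greenCoeff_comm (m : ℕ) (z z' : Gasket q) : greenCoeff q m z z' = greenCoeff q m z' z := by
  unfold greenCoeff
  rw [show Adj q (m + 1) z z' = Adj q (m + 1) z' z from propext ⟨Adj.symm, Adj.symm⟩]
  simp only [eq_comm]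

theorem greenLevel_comm (m : ℕ) (x y : Gasket q) : greenLevel m x y = greenLevel m y x := by
  unfold greenLevel
  rw [Finset.sum_comm]
  refine Finset.sum_congr rfl fun z _ => Finset.sum_congr rfl fun z' _ => ?_
  rw [greenCoeff_comm]
  ring

theorem greenCoeff_F (hq : IsEquilateral q) (m : ℕ) {z z' : Gasket q} (hz : z ∉ V q 0)
    (hz' : z' ∉ V q 0) (i j : Fin 3) :
    greenCoeff q (m + 1) (F q i z) (F q j z')
      = if i = j then 3 / 5 * greenCoeff q m z z' else 0 := by
  by_cases hij : i = j
  · subst hij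
    rw [if_pos rfl, greenCoeff, greenCoeff, propext (adj_F hq hz), pow_succ]
    simp only [F_inj]
    split_ifs <;> ring
  · rw [if_neg hij]
    have h1 : F q i z ≠ F q j z' := fun h =>
      hz' (mem_V_zero.2 ⟨i, right_eq_corner hq hij h⟩)
    have h2 : ¬ Adj q (m + 1 + 1) (F q i z) (F q j z') := by
      rw [adj_succ]
      rintro ⟨k, x', y', hx, hy, -⟩
      have hik : i = k := by
        by_contra hik
        exact hz (mem_V_zero.2 ⟨k, right_eq_corner hq (Ne.symm hik) hx.symm⟩)
      have hjk : j = k := by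
        by_contra hjk
        exact hz' (mem_V_zero.2 ⟨k, right_eq_corner hq (Ne.symm hjk) hy.symm⟩)
      exact hij (hik.trans hjk.symm)
    simp only [greenCoeff, if_neg h1, if_neg h2]

theorem interp_delta_F (hq : IsEquilateral q) (m : ℕ) {z : Gasket q} (hz : z ∉ V q 0)
    (i j : Fin 3) (x : Gasket q) :
    interp (m + 1) (delta (F q i z)) (F q j x) = if i = j then interp m (delta z) x else 0 := by
  rw [interp_F hq]
  split_ifs with hij
  · subst hij
    rw [delta_F_comp]
  · rw [delta_F_comp_of_ne hq hz hij, interp_zero hq]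

/-- From the second level on, a new vertex and its tent live in a single cell of level one, and the
coefficient $g$ couples only vertices of the same cell. What remains is the preceding level, with
$(3/5)^{m+1}$ in place of $(3/5)^m$. -/
theorem greenLevel_F (hq : IsEquilateral q) (m : ℕ) (i j : Fin 3) (x y : Gasket q) :
    greenLevel (m + 1) (F q i x) (F q j y) = if i = j then 3 / 5 * greenLevel m x y else 0 := by
  classical
  unfold greenLevel
  rw [sum_V_sdiff_succ hq]
  simp only [sum_V_sdiff_succ hq m fun z' => greenCoeff q (m + 1) _ z' *
    interp (m + 1 + 1) (delta _) (F q i x) * interp (m + 1 + 1) (delta z') (F q j y)]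
  have h : ∀ k l, ∀ z ∈ V q (m + 1) \ V q m, ∀ z' ∈ V q (m + 1) \ V q m,
      greenCoeff q (m + 1) (F q k z) (F q l z') *
        interp (m + 1 + 1) (delta (F q k z)) (F q i x) *
        interp (m + 1 + 1) (delta (F q l z')) (F q j y)
      = if k = i then (if l = j then (if i = j then 3 / 5 * (greenCoeff q m z z' *
        interp (m + 1) (delta z) x * interp (m + 1) (delta z') y) else 0) else 0) else 0 := by
    intro k l z hz z' hz'
    have hz0 := notMem_V_zero_of_sdiff (Finset.mem_sdiff.1 hz).2
    have hz0' := notMem_V_zero_of_sdiff (Finset.mem_sdiff.1 hz').2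
    rw [greenCoeff_F hq m hz0 hz0', interp_delta_F hq _ hz0, interp_delta_F hq _ hz0']
    by_cases hk : k = i
    · by_cases hl : l = j
      · subst hk hl
        simp only [if_true]
        split_ifs <;> ring
      · simp [hl]
    · simp [hk]
  rw [Finset.sum_eq_single i]
  · have h1 : ∀ z ∈ V q (m + 1) \ V q m, ∑ l, ∑ z' ∈ V q (m + 1) \ V q m,
        greenCoeff q (m + 1) (F q i z) (F q l z') *
        interp (m + 1 + 1) (delta (F q i z)) (F q i x) *
        interp (m + 1 + 1) (delta (F q l z')) (F q j y)
        = ∑ z' ∈ V q (m + 1) \ V q m, if i = j then 3 / 5 * (greenCoeff q m z z' *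
        interp (m + 1) (delta z) x * interp (m + 1) (delta z') y) else 0 := by
      intro z hz
      rw [Finset.sum_eq_single j]
      · exact Finset.sum_congr rfl fun z' hz' => by rw [h _ _ z hz z' hz', if_pos rfl, if_pos rfl]
      · intro l _ hl
        exact Finset.sum_eq_zero fun z' hz' => by rw [h _ _ z hz z' hz', if_pos rfl, if_neg hl]
      · simp
    rw [Finset.sum_congr rfl h1]
    split_ifs
    · simp only [Finset.mul_sum]
    · simp
  · intro k _ hk
    refine Finset.sum_eq_zero fun z hz => Finset.sum_eq_zero fun l _ =>
      Finset.sum_eq_zero fun z' hz' => ?_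
    rw [h _ _ z hz z' hz', if_neg hk]
  · simp

/-- The values at the vertices of `F_i(SG)` of the indicator of the junction point opposite
to `q_k`. -/
noncomputable def midValues (k i j : Fin 3) : ℝ := if i ≠ j ∧ i ≠ k ∧ j ≠ k then 1 else 0

theorem delta_mid (hq : IsEquilateral q) (k i j : Fin 3) :
    delta (mid k) (F q i (corner q j)) = midValues k i j := by
  have h : (i = k + 1 ∧ j = k + 2 ∨ i = k + 2 ∧ j = k + 1) ↔ (i ≠ j ∧ i ≠ k ∧ j ≠ k) := by
    revert i j k
    decide
  unfold delta midValues mid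
  simp only [F_corner_eq_iff hq, h]

theorem interp_delta_mid_F (hq : IsEquilateral q) (k i : Fin 3) (x : Gasket q) :
    interp 1 (delta (mid k)) (F q i x) = harm (midValues k i) x := by
  rw [interp_F hq, interp]
  congr 1
  funext j
  exact delta_mid hq k i j

/-- Any two of the three midpoints are adjacent: those opposite to $q_k$ and $q_l$ both lie in the
cell at the third corner. -/
theorem greenCoeff_mid (hq : IsEquilateral q) (k l : Fin 3) :
    greenCoeff q 0 (mid k) (mid l) = if k = l then 9 / 50 else 3 / 50 := by
  unfold greenCoeff
  simp only [(mid_injective hq).eq_iff, pow_zero, mul_one]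
  by_cases hkl : k = l
  · simp [hkl]
  · rw [if_neg hkl, if_neg hkl, if_pos]
    rw [adj_succ]
    have : ∃ n : Fin 3, (k + 1 = n ∧ k + 2 = l ∨ k + 1 = l ∧ k + 2 = n) ∧
        (l + 1 = n ∧ l + 2 = k ∨ l + 1 = k ∧ l + 2 = n) := by
      revert k l
      decide
    obtain ⟨n, h1, h2⟩ := this
    exact ⟨n, corner q l, corner q k, (F_corner_eq_iff hq).2 h1, (F_corner_eq_iff hq).2 h2,
      adj_zero.2 ⟨fun h => hkl (corner_injective hq h).symm, l, k, rfl, rfl⟩⟩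

theorem greenLevel_zero (hq : IsEquilateral q) (x y : Gasket q) :
    greenLevel 0 x y = ∑ k, (∑ l, (if k = l then 9 / 50 else 3 / 50) *
      interp 1 (delta (mid l)) y) * interp 1 (delta (mid k)) x := by
  classical
  unfold greenLevel
  rw [V_one_sdiff hq, Finset.sum_image fun a _ b _ h => mid_injective hq h]
  refine Finset.sum_congr rfl fun k _ => ?_
  rw [Finset.sum_image fun a _ b _ h => mid_injective hq h, Finset.sum_mul]
  refine Finset.sum_congr rfl fun l _ => ?_
  rw [greenCoeff_mid hq]
  ring

theorem harm_sum_three (hq : IsEquilateral q) (r : Fin 3 → ℝ) (a : Fin 3 → Fin 3 → ℝ)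
    (x : Gasket q) : harm (fun j => ∑ k, r k * a k j) x = ∑ k, r k * harm (a k) x := by
  have : (fun j => ∑ k, r k * a k j) = r 0 • a 0 + r 1 • a 1 + r 2 • a 2 := by
    funext j
    simp [Fin.sum_univ_three]
  rw [this, harm_add hq, harm_add hq, harm_smul hq, harm_smul hq, harm_smul hq,
    Fin.sum_univ_three]

theorem greenLevel_zero_F (hq : IsEquilateral q) (i : Fin 3) (x y : Gasket q) :
    greenLevel 0 (F q i x) y = harm (fun j => greenLevel 0 (F q i (corner q j)) y) x := by
  simp only [greenLevel_zero hq, interp_delta_mid_F hq, harm_corner hq]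
  rw [harm_sum_three hq]

/-- The difference is harmonic on cells of level one and vanishes at the corners, so it is a
combination of the three midpoint tents. The coefficient is $\varphi$ minus its harmonic extension
at the midpoint, given by the 1/5–2/5 rule. -/
theorem interp_one_sub_interp_zero (hq : IsEquilateral q) (φ : Gasket q → ℝ) (y : Gasket q) :
    interp 1 φ y - interp 0 φ y = ∑ k, (φ (mid k) - (2 * (φ (corner q 0) + φ (corner q 1) +
      φ (corner q 2)) - φ (corner q k)) / 5) * interp 1 (delta (mid k)) y := by
  obtain ⟨n, y, rfl⟩ := exists_F y
  simp only [interp_delta_mid_F hq]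
  rw [← harm_sum_three hq, interp_F hq, interp, interp, harm_F hq, ← harm_sub hq]
  congr 1
  funext j
  simp only [Pi.sub_apply, Function.comp_apply, Fin.sum_univ_three, mid]
  fin_cases n <;> fin_cases j <;>
    simp [midValues, cellValues, F_corner, F_corner_comm hq 1 0, F_corner_comm hq 2 0,
      F_corner_comm hq 2 1] <;> ring

/-- This explains the constants in $g$. The level-one energy matrix of the midpoint tents has $4$ on
the diagonal and $-1$ elsewhere. Its inverse has entries $3/10$ and $1/10$, and the renormalization
$5/3$ turns these into $9/50$ and $3/50$. -/
theorem energy_one_greenLevel_zero (hq : IsEquilateral q) (φ : Gasket q → ℝ) (y : Gasket q) :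
    5 / 3 * energy 1 (fun x => greenLevel 0 x y) φ = interp 1 φ y - interp 0 φ y := by
  rw [interp_one_sub_interp_zero hq]
  simp only [energy, greenLevel_zero hq, triEnergy, Function.comp_apply]
  simp only [interp_delta_mid_F hq, harm_corner hq]
  simp only [Fin.sum_univ_three, mid]
  simp [midValues, F_corner, F_corner_comm hq 1 0, F_corner_comm hq 2 0, F_corner_comm hq 2 1]
  ring

theorem continuous_greenLevel (hq : IsEquilateral q) (m : ℕ) :
    Continuous fun z : Gasket q × Gasket q => greenLevel m z.1 z.2 :=
  continuous_finsetSum _ fun _ _ => continuous_finsetSum _ fun _ _ =>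
    (continuous_const.mul ((continuous_interp hq _ _).comp continuous_fst)).mul
      ((continuous_interp hq _ _).comp continuous_snd)

/-! ### Convergence and reproducing property of Green's function -/

theorem exists_greenLevel_bound (hq : IsEquilateral q) :
    ∃ C, ∀ (m : ℕ) (x y : Gasket q), ‖greenLevel m x y‖ ≤ C * (3 / 5) ^ m := by
  obtain ⟨C, hC⟩ := (isCompact_univ (X := Gasket q × Gasket q)).exists_bound_of_continuousOn
    (continuous_greenLevel hq 0).continuousOn
  have h0 : ∀ x y : Gasket q, ‖greenLevel 0 x y‖ ≤ C := fun x y => hC (x, y) (Set.mem_univ _)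
  refine ⟨C, fun m => ?_⟩
  induction m with
  | zero => simpa using h0
  | succ m ih =>
    intro x y
    obtain ⟨i, x, rfl⟩ := exists_F x
    obtain ⟨j, y, rfl⟩ := exists_F y
    rw [greenLevel_F hq]
    split_ifs
    · rw [norm_mul, Real.norm_of_nonneg (by norm_num), pow_succ]
      linarith [ih x y]
    · rw [norm_zero]
      have : 0 ≤ C := (norm_nonneg _).trans (h0 x y)
      positivity

/-- Green's function, as the sum of a series. -/
noncomputable def greenFn (x y : Gasket q) : ℝ := ∑' m, greenLevel m x y

theorem summable_three_fifths (C : ℝ) : Summable fun m : ℕ => C * (3 / 5 : ℝ) ^ m :=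
  (summable_geometric_of_lt_one (by norm_num) (by norm_num)).mul_left C

theorem summable_greenLevel (hq : IsEquilateral q) (x y : Gasket q) :
    Summable fun m => greenLevel m x y := by
  obtain ⟨C, hC⟩ := exists_greenLevel_bound hq
  exact Summable.of_norm_bounded (summable_three_fifths C) fun m => hC m x y

theorem continuous_greenFn (hq : IsEquilateral q) :
    Continuous fun z : Gasket q × Gasket q => greenFn z.1 z.2 := by
  obtain ⟨C, hC⟩ := exists_greenLevel_bound hq
  exact continuous_tsum (continuous_greenLevel hq) (summable_three_fifths C) fun m z => hC m _ _

theorem greenFn_comm (x y : Gasket q) : greenFn x y = greenFn y x := by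
  unfold greenFn
  simp only [greenLevel_comm _ x y]

theorem greenFn_F (hq : IsEquilateral q) (i j : Fin 3) (x y : Gasket q) :
    greenFn (F q i x) (F q j y) = greenLevel 0 (F q i x) (F q j y)
      + (if i = j then 3 / 5 else 0) * greenFn x y := by
  unfold greenFn
  rw [(summable_greenLevel hq _ _).tsum_eq_zero_add]
  congr 1
  simp only [greenLevel_F hq]
  split_ifs
  · exact tsum_mul_left
  · simp

theorem greenFn_corner (hq : IsEquilateral q) (i : Fin 3) (y : Gasket q) :
    greenFn (corner q i) y = 0 := by
  classical
  unfold greenFn greenLevel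
  convert tsum_zero with m
  refine Finset.sum_eq_zero fun z hz => Finset.sum_eq_zero fun z' _ => ?_
  rw [interp_corner hq, delta_of_ne, mul_zero, zero_mul]
  rintro rfl
  exact (Finset.mem_sdiff.1 hz).2 (corner_mem_V m i)

/-- Green's function represents the interpolation operators with respect to the energy. -/
theorem energy_greenFn (hq : IsEquilateral q) (m : ℕ) (φ : Gasket q → ℝ) (y : Gasket q) :
    (5 / 3) ^ m * energy m (fun x => greenFn x y) φ = interp m φ y - interp 0 φ y := by
  induction m generalizing φ y with
  | zero => simp [energy, greenFn_corner hq, triEnergy]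
  | succ m ih =>
    obtain ⟨j, y, rfl⟩ := exists_F y
    have h1 : ∀ i, (5 / 3) ^ m * energy m ((fun x => greenFn x (F q j y)) ∘ F q i) (φ ∘ F q i)
        = triEnergy (fun k => greenLevel 0 (F q i (corner q k)) (F q j y))
          (fun k => φ (F q i (corner q k))) + (if i = j then 3 / 5 else 0) *
          (interp m (φ ∘ F q i) y - interp 0 (φ ∘ F q i) y) := by
      intro i
      -- On each cell $G(\cdot,F_jy)$ is harmonic plus, if $i=j$, a scaled copy of $G(\cdot,y)$. The
      -- harmonic parts add up to a level-one energy, which gives the interpolant at level $1$ minus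
      -- that at level $0$. The copy is handled by induction, its factor $3/5$ cancelling $5/3$, and
      -- the sum telescopes.
      have h2 : (fun x => greenFn x (F q j y)) ∘ F q i = fun x =>
          harm (fun k => greenLevel 0 (F q i (corner q k)) (F q j y)) x
            + (if i = j then 3 / 5 else 0) * greenFn x y := by
        funext x
        rw [Function.comp_apply, greenFn_F hq, greenLevel_zero_F hq]
      rw [h2, energy_add_left, energy_mul_left, mul_add, energy_harm hq, ← ih]
      simp only [Function.comp_apply]
      ring
    have h3 := energy_one_greenLevel_zero hq φ (F q j y)
    rw [energy, pow_succ', mul_assoc, Finset.mul_sum]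
    simp only [h1, Finset.sum_add_distrib]
    rw [mul_add]
    rw [show ∑ i, triEnergy (fun k => greenLevel 0 (F q i (corner q k)) (F q j y))
          (fun k => φ (F q i (corner q k))) = energy 1 (fun x => greenLevel 0 x (F q j y)) φ
      from rfl, h3]
    simp only [ite_mul, zero_mul, Finset.sum_ite_eq', Finset.mem_univ, if_true]
    rw [interp_F hq, interp_F hq]
    ring

/-! ### The solution operator -/

/-- The function `-∫ G(·, y) f(y) dμ(y)`. -/
noncomputable def potential (f : Gasket q → ℝ) (x : Gasket q) : ℝ :=
  -∫ y, greenFn x y * f y ∂(μ q)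

theorem continuous_greenFn_apply (hq : IsEquilateral q) (x : Gasket q) :
    Continuous (greenFn x) := by
  have h := (continuous_greenFn hq).comp (Continuous.prodMk_right x)
  exact h

theorem integrable_greenFn_mul (hq : IsEquilateral q) {f : Gasket q → ℝ} (hf : Continuous f)
    (x : Gasket q) : Integrable (fun y => greenFn x y * f y) (μ q) :=
  integrable_of_continuous ((continuous_greenFn_apply hq x).mul hf)

theorem continuous_potential (hq : IsEquilateral q) {f : Gasket q → ℝ} (hf : Continuous f) :
    Continuous (potential f) := by
  have h : Continuous fun x => ∫ y in Set.univ, greenFn x y * f y ∂(μ q) :=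
    continuous_parametric_integral_of_continuous
      ((continuous_greenFn hq).mul (hf.comp continuous_snd)) isCompact_univ
  simp only [Measure.restrict_univ] at h
  exact h.neg

theorem potential_corner (hq : IsEquilateral q) (f : Gasket q → ℝ) (i : Fin 3) :
    potential f (corner q i) = 0 := by
  simp [potential, greenFn_corner hq]

theorem potential_add (hq : IsEquilateral q) {f g : Gasket q → ℝ} (hf : Continuous f)
    (hg : Continuous g) : potential (f + g) = potential f + potential g := by
  funext x
  simp only [potential, Pi.add_apply, mul_add]
  rw [integral_add (integrable_greenFn_mul hq hf x) (integrable_greenFn_mul hq hg x)]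
  ring

theorem potential_smul (r : ℝ) (f : Gasket q → ℝ) : potential (r • f) = r • potential f := by
  funext x
  simp only [potential, Pi.smul_apply, smul_eq_mul, mul_left_comm _ r]
  rw [integral_const_mul]
  ring

/-- The energy is a finite linear combination of values at vertices, so it commutes with the
integral. Integrability is carried along for the induction. -/
theorem energy_integral {K : Gasket q → Gasket q → ℝ}
    (hK : ∀ x, Integrable (K x) (μ q)) (m : ℕ) (φ : Gasket q → ℝ) :
    Integrable (fun y => energy m (fun x => K x y) φ) (μ q) ∧
      energy m (fun x => ∫ y, K x y ∂(μ q)) φ = ∫ y, energy m (fun x => K x y) φ ∂(μ q) := by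
  induction m generalizing K φ with
  | zero =>
    have h : ∀ i j, Integrable (fun y => (K (corner q i) y - K (corner q j) y) *
        (φ (corner q i) - φ (corner q j))) (μ q) := fun i j => ((hK _).sub (hK _)).mul_const _
    refine ⟨((h 0 1).add (h 0 2)).add (h 1 2), ?_⟩
    simp only [energy, triEnergy]
    have h3 := integral_add (f := fun y => (K (corner q 0) y - K (corner q 1) y) *
      (φ (corner q 0) - φ (corner q 1)) + (K (corner q 0) y - K (corner q 2) y) *
      (φ (corner q 0) - φ (corner q 2))) ((h 0 1).add (h 0 2)) (h 1 2)
    rw [h3, integral_add (h 0 1) (h 0 2)]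
    simp only [integral_mul_const]
    rw [integral_sub (hK _) (hK _), integral_sub (hK _) (hK _), integral_sub (hK _) (hK _)]
  | succ m ih =>
    have h := fun i => ih (K := fun x => K (F q i x)) (fun x => hK _) (φ ∘ F q i)
    refine ⟨integrable_finsetSum _ fun i _ => (h i).1, ?_⟩
    simp only [energy]
    refine Eq.trans ?_ (integral_finsetSum _ fun i _ => (h i).1).symm
    exact Finset.sum_congr rfl fun i _ => (h i).2

theorem energy_potential (hq : IsEquilateral q) {f : Gasket q → ℝ} (hf : Continuous f) (m : ℕ)
    (φ : Gasket q → ℝ) : (5 / 3) ^ m * energy m (potential f) φ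
      = -∫ y, (interp m φ y - interp 0 φ y) * f y ∂(μ q) := by
  have h1 : potential f = fun x => -1 * ∫ y, greenFn x y * f y ∂(μ q) := by
    funext x
    simp [potential]
  rw [h1, energy_mul_left, (energy_integral (integrable_greenFn_mul hq hf) m φ).2,
    mul_left_comm, ← integral_const_mul, neg_one_mul]
  congr 2
  funext y
  simp only [mul_comm _ (f y), energy_mul_left]
  rw [mul_left_comm, energy_greenFn hq]

theorem integral_interp_delta_corner (hq : IsEquilateral q) (m : ℕ) (i : Fin 3) :
    ∫ y, interp m (delta (corner q i)) y ∂(μ q) = 1 / 3 ^ (m + 1) := by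
  induction m with
  | zero =>
    have : ∀ j, delta (corner q i) (corner q j) = if j = i then 1 else 0 := fun j => by
      simp [delta, (corner_injective hq).eq_iff]
    simp only [interp, integral_harm hq, this]
    simp
  | succ m ih =>
    rw [integral_self_similar (continuous_interp hq _ _)]
    simp only [interp_F hq]
    rw [Finset.sum_eq_single i]
    · rw [show delta (corner q i) ∘ F q i = delta (corner q i) by
        conv_lhs => rw [← F_corner i, delta_F_comp], ih, pow_succ 3 (m + 1), div_div]
    · intro j _ hj
      rw [delta_comp_of_forall_ne fun y h => hj (F_eq_corner hq h.symm).1]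
      simp [interp_zero hq]
    · simp

/-- An interior vertex of $V_m$ lies in exactly two cells of level $m$, each of mass $3^{-m}$, and
the tent has mean $1/3$ on each. The induction descends to the level where the vertex is a junction
$F_iq_j=F_jq_i$; there the two cells separate. -/
theorem integral_interp_delta (hq : IsEquilateral q) {m : ℕ} {x : Gasket q} (hx : x ∈ V q m)
    (hx0 : x ∉ V q 0) : ∫ y, interp m (delta x) y ∂(μ q) = 2 / 3 ^ (m + 1) := by
  induction m generalizing x with
  | zero => exact absurd hx hx0
  | succ m ih =>
    obtain ⟨i, x, hx', rfl⟩ := mem_V_succ.1 hx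
    rw [integral_self_similar (continuous_interp hq _ _)]
    simp only [interp_F hq]
    by_cases h : x ∈ V q 0
    · obtain ⟨j, rfl⟩ := mem_V_zero.1 h
      have hij : i ≠ j := by
        rintro rfl
        exact hx0 (mem_V_zero.2 ⟨i, F_corner i⟩)
      rw [← Finset.sum_subset (Finset.subset_univ {i, j}), Finset.sum_pair hij, delta_F_comp,
        F_corner_comm hq i j, delta_F_comp, integral_interp_delta_corner hq,
        integral_interp_delta_corner hq]
      · rw [pow_succ 3 (m + 1), ← div_div, ← add_div]
        norm_num
      · intro k _ hk
        simp only [Finset.mem_insert, Finset.mem_singleton, not_or] at hk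
        rw [delta_comp_of_forall_ne fun y hy => ?_]
        · simp [interp_zero hq]
        · have := corner_injective hq (right_eq_corner hq hk.1 hy.symm)
          exact hk.2 this.symm
    · rw [Finset.sum_eq_single i, delta_F_comp, ih hx' h]
      · rw [pow_succ 3 (m + 1), div_div]
      · intro j _ hj
        rw [delta_F_comp_of_ne hq h hj.symm]
        simp [interp_zero hq]
      · simp

/-- The potential of `f` solves the Dirichlet problem for `Δ u = f`. -/
theorem hasLaplacian_potential (hq : IsEquilateral q) {f : Gasket q → ℝ} (hf : Continuous f) :
    HasLaplacian q (potential f) f := by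
  refine ⟨continuous_potential hq hf, hf, fun ε hε => ?_⟩
  obtain ⟨D, hD⟩ := exists_dist_bound (q := q)
  obtain ⟨δ, hδ, hfδ⟩ := Metric.uniformContinuous_iff.1
    (CompactSpace.uniformContinuous_of_continuous hf) (ε / 2) (by positivity)
  obtain ⟨M, hM⟩ := eventually_atTop.1 ((tendsto_div_two_pow D).eventually (gt_mem_nhds hδ))
  refine ⟨M, fun m hm x hx hx0 => ?_⟩
  set ψ := interp m (delta x)
  have hψc : Continuous ψ := continuous_interp hq _ _
  have hψ0 : ∀ y, 0 ≤ ψ y := interp_nonneg hq m (delta_nonneg x)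
  have hψi : ∫ y, ψ y ∂(μ q) = 2 / 3 ^ (m + 1) := integral_interp_delta hq hx hx0
  have hd : (fun i => delta x (corner q i)) = 0 :=
    funext fun i => delta_of_ne fun h => hx0 (mem_V_zero.2 ⟨i, h.symm⟩)
  -- Since $\tfrac32 5^m=\tfrac12 3^{m+1}(5/3)^m$ and $\tfrac12 3^{m+1}=1/\int\psi$, the
  -- renormalized Laplacian is the $\psi$-weighted average of $f$.
  have hE : 3 / 2 * 5 ^ m * graphLaplacian q m (potential f) x
      = 3 ^ (m + 1) / 2 * ∫ y, ψ y * f y ∂(μ q) := by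
    have h := energy_potential hq hf m (delta x)
    simp only [show ∀ y, interp 0 (delta x) y = 0 from fun y => by
      rw [interp, hd]; exact harm_zero hq y, sub_zero] at h
    rw [graphLaplacian_eq_neg_energy hq, ← neg_neg (∫ y, ψ y * f y ∂(μ q)), ← h, div_pow]
    field_simp
    ring
  have hfx : f x = 3 ^ (m + 1) / 2 * ∫ y, ψ y * f x ∂(μ q) := by
    rw [integral_mul_const, hψi]
    field_simp
  rw [hE]
  conv_lhs => rw [hfx]
  have hsub := integral_sub (f := fun y => ψ y * f y) (g := fun y => ψ y * f x)
    (integrable_of_continuous (q := q) (hψc.mul hf))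
    (integrable_of_continuous (hψc.mul continuous_const))
  rw [← mul_sub, ← hsub, abs_mul, abs_of_pos (by positivity)]
  -- On the support of the tent, within $D/2^m<\delta$ of $x$, uniform continuity bounds
  -- $|f(y)-f(x)|$ by $\varepsilon/2$.
  have hle : |∫ y, (ψ y * f y - ψ y * f x) ∂(μ q)| ≤ ∫ y, ε / 2 * ψ y ∂(μ q) := by
    refine (abs_integral_le_integral_abs).trans (integral_mono
      (integrable_of_continuous ((hψc.mul hf).sub (hψc.mul continuous_const)).abs)
      (integrable_of_continuous (continuous_const.mul hψc)) fun y => ?_)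
    rw [← mul_sub, abs_mul, abs_of_nonneg (hψ0 y), mul_comm]
    by_cases hxy : dist x y ≤ D / 2 ^ m
    · have h1 := hfδ (hxy.trans_lt (hM m hm))
      rw [dist_comm, Real.dist_eq] at h1
      exact mul_le_mul_of_nonneg_right h1.le (hψ0 y)
    · have : ψ y = 0 := interp_delta_eq_zero_of_dist_lt hq hD m x y (not_le.1 hxy)
      simp [this]
  rw [integral_const_mul, hψi] at hle
  calc 3 ^ (m + 1) / 2 * |∫ y, (ψ y * f y - ψ y * f x) ∂(μ q)|
      ≤ 3 ^ (m + 1) / 2 * (ε / 2 * (2 / 3 ^ (m + 1))) := by gcongr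
    _ = ε / 2 := by field_simp
    _ < ε := by linarith

/-- Uniqueness for the Dirichlet problem. -/
theorem HasLaplacian.eq_zero (hq : IsEquilateral q) {u : Gasket q → ℝ} (hu : HasLaplacian q u 0)
    (h0 : ∀ i, u (corner q i) = 0) : u = 0 := by
  have key : ∀ u : Gasket q → ℝ, HasLaplacian q u 0 → (∀ i, u (corner q i) = 0) →
      ∀ x, u x ≤ 0 := by
    intro u hu h0 x
    -- Adding $\varepsilon\varphi$, where $\Delta\varphi=1$ and $\varphi=0$ on $V_0$, makes the
    -- graph Laplacian strictly positive at all large levels, as the discrete maximum principle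
    -- requires. Then $\varepsilon\to0$.
    set φ : Gasket q → ℝ := potential fun _ => 1
    have hφ : HasLaplacian q φ fun _ => 1 := hasLaplacian_potential hq continuous_const
    have hle : ∀ ε > 0, u x + ε * φ x ≤ 0 := by
      intro ε hε
      have hs := hu.add (hφ.smul ε)
      have hpos : ∃ M, ∀ m ≥ M, ∀ x ∈ V q m, x ∉ V q 0 →
          0 < graphLaplacian q m (u + ε • φ) x := by
        obtain ⟨M, hM⟩ := hs.2.2 ε hε
        refine ⟨M, fun m hm x hx hx0 => ?_⟩
        have h1 := (abs_lt.1 (hM m hm x hx hx0)).1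
        simp only [Pi.add_apply, Pi.zero_apply, Pi.smul_apply, smul_eq_mul, mul_one,
          zero_add] at h1
        refine pos_of_mul_pos_right (a := 3 / 2 * 5 ^ m) ?_ (by positivity)
        linarith
      obtain ⟨M, hM⟩ := hpos
      refine forall_of_forall_V hq hs.1 (fun m x hx _ => ?_) x
      refine le_of_graphLaplacian_pos (hM (max m M) (le_max_right _ _)) (fun i => ?_)
        (V_mono (le_max_left m M) hx)
      simp [h0, φ, potential_corner hq]
    have hlim : Tendsto (fun ε : ℝ => u x + ε * φ x) (𝓝[>] 0) (𝓝 (u x + 0 * φ x)) :=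
      (tendsto_const_nhds.add (tendsto_id.mul_const _)).mono_left nhdsWithin_le_nhds
    rw [zero_mul, add_zero] at hlim
    exact le_of_tendsto hlim (eventually_mem_nhdsWithin.mono fun ε hε => hle ε hε)
  funext x
  refine le_antisymm (key u hu h0 x) ?_
  have := key (-u) (by simpa using hu.smul (-1)) (by simp [h0]) x
  simpa using this

theorem HasLaplacian.ext (hq : IsEquilateral q) {u v f : Gasket q → ℝ} (hu : HasLaplacian q u f)
    (hv : HasLaplacian q v f) (h : ∀ i, u (corner q i) = v (corner q i)) : u = v := by
  have h1 := hu.sub hv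
  rw [sub_self] at h1
  exact sub_eq_zero.1 (h1.eq_zero hq fun i => by simp [h])

theorem HasLaplacian.eq_harm (hq : IsEquilateral q) {u : Gasket q → ℝ}
    (hu : HasLaplacian q u 0) : u = harm fun i => u (corner q i) :=
  hu.ext hq (hasLaplacian_harm hq _) fun i =>
    (harm_corner hq (fun i => u (corner q i)) i).symm

/-! ### Identification of the tents and of Green's function -/

theorem interp_comp_Fw_harm (hq : IsEquilateral q) {m : ℕ} (φ : Gasket q → ℝ) {w : List (Fin 3)}
    (hw : w.length = m) : ∃ a, interp m φ ∘ Fw q w = harm a := by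
  induction m generalizing φ w with
  | zero =>
    rw [List.length_eq_zero_iff] at hw
    subst hw
    exact ⟨_, rfl⟩
  | succ m ih =>
    obtain ⟨i, w, rfl⟩ := List.exists_cons_of_length_eq_add_one hw
    obtain ⟨a, ha⟩ := ih (φ ∘ F q i) (w := w) (by simpa using hw)
    refine ⟨a, ?_⟩
    rw [← ha]
    funext x
    exact interp_F hq m φ i _

theorem eq_interp (hq : IsEquilateral q) {m : ℕ} {u φ : Gasket q → ℝ}
    (hu : ∀ w : List (Fin 3), w.length = m → HasLaplacian q (u ∘ Fw q w) 0)
    (h : ∀ x ∈ V q m, u x = φ x) : u = interp m φ := by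
  induction m generalizing u φ with
  | zero =>
    rw [HasLaplacian.eq_harm hq (u := u) (hu [] rfl), interp]
    congr 1
    funext i
    exact h _ (corner_mem_V 0 i)
  | succ m ih =>
    funext x
    obtain ⟨i, x, rfl⟩ := exists_F x
    rw [interp_F hq]
    exact congrFun (ih (u := u ∘ F q i) (fun w hw => hu (i :: w) (by simp [hw]))
      fun y hy => h _ (mem_V_succ.2 ⟨i, y, hy, rfl⟩)) x

/-- The choice behind `tent` is harmless: the interpolant of the indicator is a tent, and uniqueness
for the Dirichlet problem on each cell leaves no other. -/
theorem tent_eq_interp (hq : IsEquilateral q) (m : ℕ) (z : Gasket q) :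
    tent q m z = interp m (delta z) := by
  have hex : ∃ ψ, IsTent q m z ψ := by
    refine ⟨interp m (delta z), continuous_interp hq _ _, fun w hw => ?_, fun x hx =>
      interp_of_mem_V hq _ hx⟩
    obtain ⟨a, ha⟩ := interp_comp_Fw_harm hq (delta z) hw
    rw [ha]
    exact hasLaplacian_harm hq a
  have h := Classical.epsilon_spec hex
  exact eq_interp hq h.2.1 h.2.2

theorem greenPartial_eq_sum (hq : IsEquilateral q) (M : ℕ) (x y : Gasket q) :
    greenPartial q M x y = ∑ m ∈ Finset.range (M + 1), greenLevel m x y := by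
  simp only [greenPartial, greenLevel, tent_eq_interp hq]

theorem tendsto_greenPartial (hq : IsEquilateral q) (x y : Gasket q) :
    Tendsto (fun M => greenPartial q M x y) atTop (𝓝 (greenFn x y)) := by
  simp only [greenPartial_eq_sum hq]
  exact (summable_greenLevel hq x y).hasSum.tendsto_sum_nat.comp (tendsto_add_atTop_nat 1)

theorem green_eq_greenFn (hq : IsEquilateral q) (x y : Gasket q) : green q x y = greenFn x y :=
  (tendsto_greenPartial hq x y).limUnder_eq

theorem negGreenOp_eq_potential (hq : IsEquilateral q) (u : Gasket q → ℝ) :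
    negGreenOp q u = potential u := by
  funext x
  simp only [negGreenOp, potential, green_eq_greenFn hq]

/-- Fubini and the symmetry of Green's function. -/
theorem ip_potential_comm (hq : IsEquilateral q) {u v : Gasket q → ℝ} (hu : Continuous u)
    (hv : Continuous v) : ip q (potential u) v = ip q u (potential v) := by
  have h1 : ∀ u v : Gasket q → ℝ, ip q (potential u) v
      = -∫ x, ∫ y, greenFn x y * u y * v x ∂(μ q) ∂(μ q) := by
    intro u v
    simp only [ip, potential, neg_mul, integral_neg, integral_mul_const]
  have h2 : ip q u (potential v) = ip q (potential v) u := by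
    simp only [ip, mul_comm]
  rw [h2, h1, h1, integral_integral_swap]
  · congr 1
    refine integral_congr_ae (Eventually.of_forall fun x => integral_congr_ae
      (Eventually.of_forall fun y => ?_))
    simp only [greenFn_comm y x]
    ring
  · refine Continuous.integrable_of_hasCompactSupport ?_ (HasCompactSupport.of_compactSpace _)
    exact ((continuous_greenFn hq).mul (hu.comp continuous_snd)).mul (hv.comp continuous_fst)

/-! ### Reflection and the Laplacian -/

theorem reflect_mem_V (hq : IsEquilateral q) {m : ℕ} {x : Gasket q} (hx : x ∈ V q m) :
    reflect x ∈ V q m := by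
  induction m generalizing x with
  | zero =>
    obtain ⟨i, rfl⟩ := mem_V_zero.1 hx
    exact mem_V_zero.2 ⟨_, reflect_corner hq i⟩
  | succ m ih =>
    obtain ⟨i, y, hy, rfl⟩ := mem_V_succ.1 hx
    exact mem_V_succ.2 ⟨_, _, ih hy, reflect_F hq i y⟩

theorem reflect_notMem_V (hq : IsEquilateral q) {m : ℕ} {x : Gasket q} (hx : x ∉ V q m) :
    reflect x ∉ V q m := fun h => hx (by simpa [reflect_reflect hq] using reflect_mem_V hq h)

theorem Adj.reflect (hq : IsEquilateral q) {m : ℕ} {x y : Gasket q} (h : Adj q m x y) :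
    Adj q m (reflect x) (reflect y) := by
  induction m generalizing x y with
  | zero =>
    obtain ⟨hne, i, j, rfl, rfl⟩ := adj_zero.1 h
    refine adj_zero.2 ⟨fun h' => hne ?_, _, _, reflect_corner hq i, reflect_corner hq j⟩
    rw [← reflect_reflect hq (corner q i), h', reflect_reflect hq]
  | succ m ih =>
    obtain ⟨i, x, y, rfl, rfl, h'⟩ := adj_succ.1 h
    exact adj_succ.2 ⟨_, _, _, reflect_F hq i x, reflect_F hq i y, ih h'⟩

theorem graphLaplacian_comp_reflect (hq : IsEquilateral q) (m : ℕ) (u : Gasket q → ℝ)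
    (x : Gasket q) :
    graphLaplacian q m (u ∘ reflect) x = graphLaplacian q m u (reflect x) := by
  classical
  unfold graphLaplacian
  refine Finset.sum_nbij' reflect reflect ?_ ?_ (fun y _ => reflect_reflect hq y)
    (fun y _ => reflect_reflect hq y) (fun y _ => rfl)
  · intro y hy
    rw [Finset.mem_filter] at hy ⊢
    exact ⟨reflect_mem_V hq hy.1, hy.2.reflect hq⟩
  · intro y hy
    rw [Finset.mem_filter] at hy ⊢
    have := hy.2.reflect hq
    rw [reflect_reflect hq] at this
    exact ⟨reflect_mem_V hq hy.1, this⟩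

theorem HasLaplacian.comp_reflect (hq : IsEquilateral q) {u f : Gasket q → ℝ}
    (h : HasLaplacian q u f) : HasLaplacian q (u ∘ reflect) (f ∘ reflect) := by
  refine ⟨h.1.comp (continuous_reflect hq), h.2.1.comp (continuous_reflect hq), fun ε hε => ?_⟩
  obtain ⟨M, hM⟩ := h.2.2 ε hε
  refine ⟨M, fun m hm x hx hx0 => ?_⟩
  rw [graphLaplacian_comp_reflect hq]
  exact hM m hm _ (reflect_mem_V hq hx) (reflect_notMem_V hq hx0)

/-- Both sides solve the same Dirichlet problem; the solution operator therefore preserves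
antisymmetry. -/
theorem potential_comp_reflect (hq : IsEquilateral q) {f : Gasket q → ℝ} (hf : Continuous f) :
    potential f ∘ reflect = potential (f ∘ reflect) :=
  ((hasLaplacian_potential hq hf).comp_reflect hq).ext hq
    (hasLaplacian_potential hq (hf.comp (continuous_reflect hq))) fun i => by
      rw [Function.comp_apply, reflect_corner hq, potential_corner hq, potential_corner hq]

/-! ### The antisymmetric monomials -/

/-- The scaling factor of the monomial `P_{j3}` under `F_0`. -/
noncomputable def scaling (j : ℕ) : ℝ := (1 / 5) ^ (j + 1)

/-- The antisymmetric monomial `P_{j3}`: it is obtained from the previous one by solving the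
Dirichlet problem and adding a harmonic function that makes the result homogeneous under `F_0`. -/
noncomputable def mono : ℕ → Gasket q → ℝ
  | 0 => harm ![0, 1 / 2, -1 / 2]
  | j + 1 => potential (mono j) +
      (potential (mono j) (F q 0 (corner q 1)) / (scaling (j + 1) / 2 - 1 / 10)) •
        harm ![0, 1 / 2, -1 / 2]

theorem hasLaplacian_mono_zero (hq : IsEquilateral q) : HasLaplacian q (mono 0) 0 :=
  hasLaplacian_harm hq _

theorem continuous_mono (hq : IsEquilateral q) (j : ℕ) : Continuous (mono j : Gasket q → ℝ) := by
  induction j with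
  | zero => exact continuous_harm hq _
  | succ j ih => exact (continuous_potential hq ih).add ((continuous_harm hq _).const_smul _)

theorem hasLaplacian_mono_succ (hq : IsEquilateral q) (j : ℕ) :
    HasLaplacian q (mono (j + 1)) (mono j) := by
  simpa [mono] using (hasLaplacian_potential hq (continuous_mono hq j)).add
    ((hasLaplacian_harm hq ![0, 1 / 2, -1 / 2]).smul
      (potential (mono j) (F q 0 (corner q 1)) / (scaling (j + 1) / 2 - 1 / 10)))

theorem mono_corner_zero (hq : IsEquilateral q) (j : ℕ) : mono j (corner q 0) = 0 := by
  cases j with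
  | zero => simp [mono, harm_corner hq]
  | succ j => simp [mono, harm_corner hq, potential_corner hq]

theorem mono_zero_comp_reflect (hq : IsEquilateral q) :
    (mono 0 : Gasket q → ℝ) ∘ reflect = -mono 0 := by
  have h := (hasLaplacian_mono_zero hq).smul (-1)
  rw [neg_one_smul, smul_zero] at h
  refine ((hasLaplacian_mono_zero hq).comp_reflect hq).ext hq h fun i => ?_
  simp only [Function.comp_apply, reflect_corner hq, mono, harm_corner hq, Pi.neg_apply]
  fin_cases i <;> simp [Equiv.swap_apply_of_ne_of_ne] <;> norm_num

theorem mono_comp_reflect (hq : IsEquilateral q) (j : ℕ) :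
    (mono j : Gasket q → ℝ) ∘ reflect = -mono j := by
  induction j with
  | zero => exact mono_zero_comp_reflect hq
  | succ j ih =>
    have h1 : potential (mono j) ∘ reflect = -potential (mono j : Gasket q → ℝ) := by
      rw [potential_comp_reflect hq (continuous_mono hq j), ih, ← neg_one_smul ℝ,
        potential_smul, neg_one_smul]
    have h2 := mono_zero_comp_reflect hq
    funext x
    have h1x := congrFun h1 x
    have h2x := congrFun h2 x
    simp only [mono, Function.comp_apply, Pi.neg_apply, Pi.add_apply, Pi.smul_apply,
      smul_eq_mul] at h1x h2x ⊢
    rw [h1x, h2x]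
    ring

theorem mono_corner_two (hq : IsEquilateral q) (j : ℕ) :
    mono j (corner q 2) = -mono j (corner q 1) := by
  have h := congrFun (mono_comp_reflect hq j) (corner q 1)
  rwa [Function.comp_apply, reflect_corner hq, Equiv.swap_apply_left] at h

theorem mono_F_zero_corner_two (hq : IsEquilateral q) (j : ℕ) :
    mono j (F q 0 (corner q 2)) = -mono j (F q 0 (corner q 1)) := by
  have h := congrFun (mono_comp_reflect hq j) (F q 0 (corner q 1))
  rwa [Function.comp_apply, reflect_F hq, reflect_corner hq, Equiv.swap_apply_left,
    Equiv.swap_apply_of_ne_of_ne (by decide) (by decide)] at h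

theorem scaling_succ_lt (j : ℕ) : scaling (j + 1) < 1 / 5 := by
  unfold scaling
  calc (1 / 5 : ℝ) ^ (j + 1 + 1) < (1 / 5) ^ 1 :=
        pow_lt_pow_right_of_lt_one₀ (by norm_num) (by norm_num) (by omega)
    _ = 1 / 5 := pow_one _

/-- This is the equation that fixes the multiple $t$ of $P_{03}$ in `mono`. With $w$ the potential
and $s$ the scaling factor it reads $w(F_0q_1)+t/10=s\,t/2$, because $w(q_1)=0$ and $P_{03}$ is
$1/10$ at $F_0q_1$ and $1/2$ at $q_1$. It is solvable since $s<1/5$. -/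
theorem mono_succ_F_zero_corner_one (hq : IsEquilateral q) (j : ℕ) :
    mono (j + 1) (F q 0 (corner q 1)) = scaling (j + 1) * mono (j + 1) (corner q 1) := by
  have h := scaling_succ_lt j
  have h1 : scaling (j + 1) / 2 - 1 / 10 ≠ 0 := by linarith
  have hv : cellValues 0 ![0, 1 / 2, -1 / 2] 1 = 1 / 10 := by
    simp [cellValues]
    norm_num
  simp only [mono, Pi.add_apply, Pi.smul_apply, harm_F hq, harm_corner hq, potential_corner hq,
    smul_eq_mul, hv]
  have hA := div_mul_cancel₀ (potential (mono j) (F q 0 (corner q 1))) h1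
  simp only [Matrix.cons_val_one, Matrix.cons_val_zero]
  linarith

/-- By induction both sides have the same Laplacian, the factor $1/5$ from $F_0$ advancing the
scaling by one. Their boundary values agree: zero at $q_0$, by the choice of the multiple at $q_1$,
by antisymmetry at $q_2$. -/
theorem mono_comp_F_zero (hq : IsEquilateral q) (j : ℕ) :
    (mono j : Gasket q → ℝ) ∘ F q 0 = scaling j • mono j := by
  induction j with
  | zero =>
    funext x
    rw [Function.comp_apply, Pi.smul_apply, smul_eq_mul, mono, harm_F hq, ← harm_smul hq]
    congr 1
    funext i
    fin_cases i <;> simp [cellValues, scaling] <;> norm_num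
  | succ j ih =>
    have h1 := hasLaplacian_comp_F hq (hasLaplacian_mono_succ hq j) 0
    have h2 := (hasLaplacian_mono_succ hq j).smul (scaling (j + 1))
    have h3 : (fun x => 1 / 5 * mono j (F q 0 x)) = scaling (j + 1) • mono j := by
      funext x
      have := congrFun ih x
      rw [Function.comp_apply] at this
      rw [this]
      simp only [Pi.smul_apply, smul_eq_mul, scaling, pow_succ _ (j + 1)]
      ring
    rw [h3] at h1
    refine h1.ext hq h2 fun i => ?_
    rw [Function.comp_apply, Pi.smul_apply, smul_eq_mul]
    fin_cases i
    · simp only [Fin.zero_eta, F_corner, mono_corner_zero hq, mul_zero]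
    · exact mono_succ_F_zero_corner_one hq j
    · simp only [Fin.reduceFinMk, mono_F_zero_corner_two hq, mono_corner_two hq,
        mono_succ_F_zero_corner_one hq, mul_neg]

theorem mono_iterate_F_zero (hq : IsEquilateral q) (j m : ℕ) (x : Gasket q) :
    mono j ((F q 0)^[m] x) = scaling j ^ m * mono j x := by
  induction m with
  | zero => simp
  | succ m ih =>
    have h := congrFun (mono_comp_F_zero hq j) ((F q 0)^[m] x)
    rw [Function.iterate_succ_apply', ← Function.comp_apply (f := mono j), h, Pi.smul_apply,
      smul_eq_mul, ih, pow_succ]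
    ring

theorem hasNormalDeriv_mono (hq : IsEquilateral q) (j : ℕ) :
    HasNormalDeriv q (mono j) 0 0 := by
  unfold HasNormalDeriv
  refine tendsto_const_nhds.congr fun m => ?_
  rw [mono_iterate_F_zero hq, mono_iterate_F_zero hq, mono_corner_zero hq, zero_add,
    show (0 - 1 : Fin 3) = 2 from rfl, mono_corner_two hq]
  ring

/-- By homogeneity the quotient at level $m$ is $(5\cdot5^{-(j+1)})^m=5^{-jm}$ times its value at
level $0$: constant for $j=0$, tending to zero otherwise. -/
theorem hasTangentialDeriv_mono (hq : IsEquilateral q) (j : ℕ) :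
    HasTangentialDeriv q (mono j) 0 (if j = 0 then 1 else 0) := by
  have h : ∀ m : ℕ, (5 : ℝ) ^ m * (mono j ((F q 0)^[m] (corner q (0 + 1)))
      - mono j ((F q 0)^[m] (corner q (0 - 1))))
      = (5 * scaling j) ^ m * (2 * mono j (corner q 1)) := by
    intro m
    rw [mono_iterate_F_zero hq, mono_iterate_F_zero hq, zero_add,
      show (0 - 1 : Fin 3) = 2 from rfl, mono_corner_two hq, mul_pow]
    ring
  unfold HasTangentialDeriv
  simp only [h]
  cases j with
  | zero =>
    have h1 : mono 0 (corner q 1) = 1 / 2 := by simp [mono, harm_corner hq]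
    simp [scaling, h1]
  | succ j =>
    have h1 := scaling_succ_lt j
    have h2 : 0 ≤ scaling (j + 1) := by unfold scaling; positivity
    rw [if_neg (Nat.succ_ne_zero j), ← zero_mul (2 * mono (j + 1) (corner q 1))]
    exact (tendsto_pow_atTop_nhds_zero_of_lt_one (by linarith) (by linarith)).mul_const _

theorem hasLaplacianPow_mono (hq : IsEquilateral q) (m j : ℕ) :
    HasLaplacianPow q m (mono (j + m)) (mono j) := by
  induction m generalizing j with
  | zero => rfl
  | succ m ih =>
    refine ⟨mono (j + 1), ?_, hasLaplacian_mono_succ hq j⟩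
    have := ih (j + 1)
    rwa [show j + 1 + m = j + (m + 1) by ring] at this

theorem isMonomial_mono (hq : IsEquilateral q) (j : ℕ) : IsMonomial q 0 3 j (mono j) := by
  refine ⟨⟨mono 0, ?_, hasLaplacian_mono_zero hq⟩, fun m hm => ⟨mono (j - m), ?_, ?_, ?_, ?_⟩⟩
  · have := hasLaplacianPow_mono hq j 0
    rwa [zero_add] at this
  · have := hasLaplacianPow_mono hq m (j - m)
    rwa [Nat.sub_add_cancel hm] at this
  · simp [mono_corner_zero hq]
  · simpa using hasNormalDeriv_mono hq (j - m)
  · have := hasTangentialDeriv_mono hq (j - m)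
    convert this using 2
    simp only [and_true]
    omega

/-! ### Uniqueness of the monomials -/

theorem HasLaplacianPow.unique (hq : IsEquilateral q) {k : ℕ} {u f g : Gasket q → ℝ}
    (hf : HasLaplacianPow q k u f) (hg : HasLaplacianPow q k u g) : f = g := by
  induction k generalizing f g with
  | zero => exact Eq.trans (a := f) hf (Eq.symm hg)
  | succ k ih =>
    obtain ⟨v, hv, hf⟩ := hf
    obtain ⟨w, hw, hg⟩ := hg
    rw [ih hv hw] at hf
    exact hf.unique hq hg

theorem HasLaplacianPow.sub {k : ℕ} {u v f g : Gasket q → ℝ}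
    (hf : HasLaplacianPow q k u f) (hg : HasLaplacianPow q k v g) :
    HasLaplacianPow q k (u - v) (f - g) := by
  induction k generalizing f g with
  | zero =>
    change f = u at hf
    change g = v at hg
    subst hf hg
    rfl
  | succ k ih =>
    obtain ⟨v, hv, hf⟩ := hf
    obtain ⟨w, hw, hg⟩ := hg
    exact ⟨v - w, ih hv hw, hf.sub hg⟩

/-- On harmonic functions vanishing at $q_0$, restriction to the cell at $q_0$ has eigenvalues $3/5$
(symmetric part) and $1/5$ (antisymmetric part). These match the renormalizations of $\partial_n$
and $\partial_T$, so value and derivatives at $q_0$ determine a harmonic function. -/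
theorem harm_iterate_F_zero (hq : IsEquilateral q) {a : Fin 3 → ℝ} (h0 : a 0 = 0) (m : ℕ) :
    harm a ((F q 0)^[m] (corner q 1)) + harm a ((F q 0)^[m] (corner q 2))
      = (3 / 5) ^ m * (a 1 + a 2) ∧
    harm a ((F q 0)^[m] (corner q 1)) - harm a ((F q 0)^[m] (corner q 2))
      = (1 / 5) ^ m * (a 1 - a 2) := by
  induction m generalizing a with
  | zero => simp [harm_corner hq]
  | succ m ih =>
    simp only [Function.iterate_succ_apply', harm_F hq]
    obtain ⟨h1, h2⟩ := ih (a := cellValues 0 a) (by simp [cellValues, h0])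
    rw [h1, h2, pow_succ, pow_succ]
    simp only [cellValues]
    simp [h0]
    constructor <;> ring

theorem HasLaplacian.eq_zero_of_jet (hq : IsEquilateral q) {u : Gasket q → ℝ}
    (hu : HasLaplacian q u 0) (h0 : u (corner q 0) = 0) (hn : HasNormalDeriv q u 0 0)
    (ht : HasTangentialDeriv q u 0 0) : u = 0 := by
  obtain ⟨a, rfl⟩ : ∃ a, u = harm a := ⟨_, hu.eq_harm hq⟩
  have ha := h0
  rw [harm_corner hq] at ha
  have hs : -(a 1 + a 2) = 0 := by
    refine tendsto_nhds_unique (tendsto_const_nhds.congr fun m => ?_) hn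
    rw [h0, zero_add, show (0 - 1 : Fin 3) = 2 from rfl, mul_zero, sub_sub, zero_sub, (harm_iterate_F_zero hq ha m).1, mul_neg, ← mul_assoc,
      ← mul_pow]
    norm_num
  have hd : a 1 - a 2 = 0 := by
    refine tendsto_nhds_unique (tendsto_const_nhds.congr fun m => ?_) ht
    rw [zero_add, show (0 - 1 : Fin 3) = 2 from rfl, (harm_iterate_F_zero hq ha m).2, ← mul_assoc,
      ← mul_pow]
    norm_num
  refine hu.eq_zero hq fun i => ?_
  rw [harm_corner hq]
  fin_cases i <;> simp <;> linarith

/-- The highest possibly nonzero power $\Delta^{k-1}w$ is harmonic with zero jet, hence zero; then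
descend. -/
theorem eq_zero_of_jets (hq : IsEquilateral q) {k : ℕ} {w : Gasket q → ℝ}
    (hw : HasLaplacianPow q k w 0) (h : ∀ m < k, ∃ v, HasLaplacianPow q m w v ∧
      v (corner q 0) = 0 ∧ HasNormalDeriv q v 0 0 ∧ HasTangentialDeriv q v 0 0) : w = 0 := by
  induction k with
  | zero => exact Eq.symm hw
  | succ k ih =>
    obtain ⟨v, hv, hv0⟩ := hw
    obtain ⟨v', hv', h0, hn, ht⟩ := h k k.lt_succ_self
    obtain rfl := hv.unique hq hv'
    rw [hv0.eq_zero_of_jet hq h0 hn ht] at hv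
    exact ih hv fun m hm => h m (hm.trans k.lt_succ_self)

theorem HasNormalDeriv.sub {u v : Gasket q → ℝ} {n : Fin 3} {a b : ℝ}
    (hu : HasNormalDeriv q u n a) (hv : HasNormalDeriv q v n b) :
    HasNormalDeriv q (u - v) n (a - b) := by
  refine (Tendsto.sub hu hv).congr fun m => ?_
  simp only [Pi.sub_apply]
  ring

theorem HasTangentialDeriv.sub {u v : Gasket q → ℝ} {n : Fin 3} {a b : ℝ}
    (hu : HasTangentialDeriv q u n a) (hv : HasTangentialDeriv q v n b) :
    HasTangentialDeriv q (u - v) n (a - b) := by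
  refine (Tendsto.sub hu hv).congr fun m => ?_
  simp only [Pi.sub_apply]
  ring

theorem IsMonomial.unique (hq : IsEquilateral q) {i j : ℕ} {u v : Gasket q → ℝ}
    (hu : IsMonomial q 0 i j u) (hv : IsMonomial q 0 i j v) : u = v := by
  rw [← sub_eq_zero]
  have h0 := hu.1.sub hv.1
  rw [sub_zero] at h0
  refine eq_zero_of_jets hq h0 fun m hm => ?_
  obtain ⟨f, hf, hf0, hfn, hft⟩ := hu.2 m (Nat.lt_succ_iff.1 hm)
  obtain ⟨g, hg, hg0, hgn, hgt⟩ := hv.2 m (Nat.lt_succ_iff.1 hm)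
  refine ⟨f - g, hf.sub hg, ?_, ?_, ?_⟩
  · rw [Pi.sub_apply, hf0, hg0, sub_self]
  · simpa using hfn.sub hgn
  · simpa using hft.sub hgt

theorem monomial_eq_mono (hq : IsEquilateral q) (j : ℕ) : monomial q 0 3 j = mono j :=
  (Classical.epsilon_spec ⟨_, isMonomial_mono hq j⟩ : IsMonomial q 0 3 j _).unique hq
    (isMonomial_mono hq j)

theorem mono_ne_zero (hq : IsEquilateral q) (j : ℕ) : (mono j : Gasket q → ℝ) ≠ 0 := by
  induction j with
  | zero =>
    intro h
    have := congrFun h (corner q 1)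
    simp [mono, harm_corner hq] at this
  | succ j ih =>
    intro h
    have h1 := hasLaplacian_mono_succ hq j
    have h2 := (hasLaplacian_mono_succ hq j).smul 0
    rw [zero_smul, zero_smul] at h2
    rw [h] at h1
    exact ih (h1.unique hq h2)

theorem scaling_injective : Function.Injective scaling := fun i j h => by
  have := pow_right_injective₀ (a := (1 / 5 : ℝ)) (by norm_num) (by norm_num) h
  omega

/-- The monomials are eigenvectors of $u\mapsto u\circ F_0$ for distinct eigenvalues. -/
theorem linearIndependent_mono (hq : IsEquilateral q) :
    LinearIndependent ℝ (mono : ℕ → Gasket q → ℝ) :=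
  Module.End.eigenvectors_linearIndependent' (LinearMap.funLeft ℝ ℝ (F q 0)) scaling
    scaling_injective mono fun j => Module.End.hasEigenvector_iff.2
      ⟨Module.End.mem_eigenspace_iff.2 (mono_comp_F_zero hq j), mono_ne_zero hq j⟩

/-! ### Gram–Schmidt and symmetric operators -/

section GramSchmidt

variable {E : Type*} [AddCommGroup E] [Module ℝ E]

/-- A sequence of vectors that is orthogonalized by the Gram–Schmidt process without
normalization, with respect to a positive definite symmetric form. -/
structure GramSchmidtData (B : LinearMap.BilinForm ℝ E) (P p : ℕ → E) : Prop where
  symm : ∀ u v, B u v = B v u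
  pos : ∀ u, u ≠ 0 → 0 < B u u
  indep : LinearIndependent ℝ P
  step : ∀ j, p j = P j - ∑ l ∈ Finset.range j, ((B (p l) (p l))⁻¹ * B (P j) (p l)) • p l

/-- The span of the first `k` vectors. -/
def headSpan (P : ℕ → E) (k : ℕ) : Submodule ℝ E := Submodule.span ℝ (P '' Set.Iio k)

theorem headSpan_mono (P : ℕ → E) {k l : ℕ} (h : k ≤ l) : headSpan P k ≤ headSpan P l :=
  Submodule.span_mono (Set.image_mono (Set.Iio_subset_Iio h))

theorem mem_headSpan (P : ℕ → E) {k l : ℕ} (h : k < l) : P k ∈ headSpan P l :=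
  Submodule.subset_span ⟨k, h, rfl⟩

namespace GramSchmidtData

variable {B : LinearMap.BilinForm ℝ E} {P p : ℕ → E}

/-- The Gram–Schmidt vectors are monic: the passage from $P$ to $p$ is unitriangular. Everything
about spans follows from this. -/
theorem sub_mem (h : GramSchmidtData B P p) (k : ℕ) : p k - P k ∈ headSpan P k := by
  induction k using Nat.strong_induction_on with
  | _ k ih =>
    rw [h.step k, sub_sub_cancel_left]
    refine Submodule.neg_mem _ (Submodule.sum_mem _ fun l hl => Submodule.smul_mem _ _ ?_)
    have hl' := Finset.mem_range.1 hl
    rw [← sub_add_cancel (p l) (P l)]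
    exact Submodule.add_mem _ (headSpan_mono P hl'.le (ih l hl')) (mem_headSpan P hl')

theorem mem_succ (h : GramSchmidtData B P p) (k : ℕ) : p k ∈ headSpan P (k + 1) := by
  rw [← sub_add_cancel (p k) (P k)]
  exact Submodule.add_mem _ (headSpan_mono P k.le_succ (h.sub_mem k)) (mem_headSpan P k.lt_succ_self)

theorem ne_zero (h : GramSchmidtData B P p) (k : ℕ) : p k ≠ 0 := by
  intro h0
  have h1 := h.sub_mem k
  rw [h0, zero_sub, Submodule.neg_mem_iff] at h1
  exact h.indep.notMem_span_image (s := Set.Iio k) (x := k) (by simp) h1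

theorem self_pos (h : GramSchmidtData B P p) (k : ℕ) : 0 < B (p k) (p k) := h.pos _ (h.ne_zero k)

theorem headSpan_le (h : GramSchmidtData B P p) (k : ℕ) : headSpan P k ≤ headSpan p k := by
  induction k with
  | zero => simp [headSpan]
  | succ k ih =>
    refine Submodule.span_le.2 ?_
    rintro _ ⟨l, hl, rfl⟩
    rcases Nat.lt_succ_iff_lt_or_eq.1 hl with hl | rfl
    · exact headSpan_mono p k.le_succ (ih (mem_headSpan P hl))
    · rw [← sub_sub_cancel (p l) (P l)]
      exact Submodule.sub_mem _ (mem_headSpan p l.lt_succ_self)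
        (headSpan_mono p l.le_succ (ih (h.sub_mem l)))

theorem orthogonal (h : GramSchmidtData B P p) {k l : ℕ} (hl : l < k) : B (p k) (p l) = 0 := by
  induction k using Nat.strong_induction_on generalizing l with
  | _ k ih =>
    rw [h.step k, map_sub, LinearMap.sub_apply, map_sum, LinearMap.sum_apply,
      Finset.sum_eq_single l]
    · rw [map_smul, LinearMap.smul_apply, smul_eq_mul, mul_right_comm,
        inv_mul_cancel₀ (h.self_pos l).ne', one_mul, sub_self]
    · intro i hi hil
      have h0 : B (p i) (p l) = 0 := by
        rcases lt_or_gt_of_ne hil with h1 | h1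
        · rw [h.symm]
          exact ih l hl h1
        · exact ih i (Finset.mem_range.1 hi) h1
      rw [map_smul, LinearMap.smul_apply, h0, smul_zero]
    · exact fun h1 => absurd (Finset.mem_range.2 hl) h1

theorem eq_zero_of_forall (h : GramSchmidtData B P p) {k : ℕ} {u : E}
    (hu : ∀ l < k, B u (p l) = 0) {v : E} (hv : v ∈ headSpan P k) : B u v = 0 := by
  have hv' := h.headSpan_le k hv
  have hle : headSpan p k ≤ LinearMap.ker (B u) := by
    refine Submodule.span_le.2 ?_
    rintro _ ⟨l, hl, rfl⟩
    exact hu l hl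
  exact hle hv'

theorem orthogonal_headSpan (h : GramSchmidtData B P p) {k : ℕ} {v : E}
    (hv : v ∈ headSpan P k) : B (p k) v = 0 :=
  h.eq_zero_of_forall (fun _ hl => h.orthogonal hl) hv

theorem map_headSpan {S : E →ₗ[ℝ] E} (hS : ∀ j, S (P j) - P (j + 1) ∈ headSpan P (j + 1))
    {k : ℕ} {v : E} (hv : v ∈ headSpan P k) : S v ∈ headSpan P (k + 1) := by
  have hle : headSpan P k ≤ (headSpan P (k + 1)).comap S := by
    refine Submodule.span_le.2 ?_
    rintro _ ⟨l, hl, rfl⟩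
    have hl : l + 1 < k + 1 := Nat.succ_lt_succ hl
    rw [SetLike.mem_coe, Submodule.mem_comap, ← sub_add_cancel (S (P l)) (P (l + 1))]
    exact Submodule.add_mem _ (headSpan_mono P hl.le (hS l)) (mem_headSpan P hl)
  exact hle hv

theorem map_sub_mem (h : GramSchmidtData B P p) {S : E →ₗ[ℝ] E}
    (hS : ∀ j, S (P j) - P (j + 1) ∈ headSpan P (j + 1)) (k : ℕ) :
    S (p k) - p (k + 1) ∈ headSpan P (k + 1) := by
  have h1 := map_headSpan hS (h.sub_mem k)
  have h2 : S (p k) - p (k + 1) = S (p k - P k) + (S (P k) - P (k + 1))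
      - (p (k + 1) - P (k + 1)) := by
    rw [map_sub]
    abel
  rw [h2]
  exact Submodule.sub_mem _ (Submodule.add_mem _ h1 (hS k)) (h.sub_mem (k + 1))

/-- A symmetric operator that raises the degree by one satisfies a recursion of finite length. -/
theorem recursion (h : GramSchmidtData B P p) {S : E →ₗ[ℝ] E}
    (hS : ∀ j, S (P j) - P (j + 1) ∈ headSpan P (j + 1)) {k : ℕ} {w : E}
    (hw : w ∈ headSpan P k) (hSw : ∀ l < k, B (S (p k)) (p l) = B w (p l)) :
    S (p k) = p (k + 1) + ((B (p k) (p k))⁻¹ * B (S (p k)) (p k)) • p k + w := by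
  set β := (B (p k) (p k))⁻¹ * B (S (p k)) (p k)
  -- The leading terms cancel, so the residual lies in the span of the first $k+1$ vectors. It is
  -- also orthogonal to them, hence zero by positivity.
  set r := S (p k) - p (k + 1) - β • p k - w with hr
  have hmem : r ∈ headSpan P (k + 1) :=
    Submodule.sub_mem _ (Submodule.sub_mem _ (h.map_sub_mem hS k)
      (Submodule.smul_mem _ _ (h.mem_succ k))) (headSpan_mono P k.le_succ hw)
  have horth : ∀ l < k + 1, B r (p l) = 0 := by
    intro l hl
    have h1 : B (p (k + 1)) (p l) = 0 := h.orthogonal hl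
    simp only [hr, map_sub, map_smul, LinearMap.sub_apply, LinearMap.smul_apply, smul_eq_mul, h1]
    rcases Nat.lt_succ_iff_lt_or_eq.1 hl with hl | rfl
    · rw [h.orthogonal hl, hSw l hl]
      ring
    · rw [h.symm w, h.orthogonal_headSpan hw]
      have := (h.self_pos l).ne'
      simp only [β]
      field_simp
      ring
  have h0 : r = 0 := by
    by_contra hne
    exact (h.pos r hne).ne' (h.eq_zero_of_forall horth hmem)
  rw [sub_eq_zero, sub_eq_iff_eq_add, sub_eq_iff_eq_add] at h0
  rw [h0]
  abel

theorem recursion_zero (h : GramSchmidtData B P p) {S : E →ₗ[ℝ] E}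
    (hS : ∀ j, S (P j) - P (j + 1) ∈ headSpan P (j + 1)) :
    S (p 0) = p 1 + ((B (p 0) (p 0))⁻¹ * B (S (p 0)) (p 0)) • p 0 := by
  have := h.recursion hS (k := 0) (w := 0) (Submodule.zero_mem _) (by simp)
  rwa [add_zero] at this

/-- Symmetry moves $S$ onto $p_l$, and $Sp_l$ is $p_{l+1}$ plus terms of lower degree. Only $l=k$
therefore contributes below $p_{k+1}$, with inner product $B(p_{k+1},p_{k+1})$. -/
theorem recursion_succ (h : GramSchmidtData B P p) {S : E →ₗ[ℝ] E}
    (hS : ∀ j, S (P j) - P (j + 1) ∈ headSpan P (j + 1)) (hsymm : ∀ u v, B (S u) v = B u (S v))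
    (k : ℕ) :
    S (p (k + 1)) = p (k + 2)
      + ((B (p (k + 1)) (p (k + 1)))⁻¹ * B (S (p (k + 1))) (p (k + 1))) • p (k + 1)
      + (B (p (k + 1)) (p (k + 1)) / B (p k) (p k)) • p k := by
  refine h.recursion hS (Submodule.smul_mem _ _ (h.mem_succ k)) fun l hl => ?_
  have h1 : B (S (p (k + 1))) (p l) = B (p (k + 1)) (p (l + 1)) := by
    rw [hsymm, ← sub_add_cancel (S (p l)) (p (l + 1)), map_add,
      h.orthogonal_headSpan (headSpan_mono P hl (h.map_sub_mem hS l)), zero_add]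
  rw [h1, map_smul, LinearMap.smul_apply, smul_eq_mul]
  rcases Nat.lt_succ_iff_lt_or_eq.1 hl with hl | rfl
  · rw [h.orthogonal (Nat.succ_lt_succ hl), h.orthogonal hl, mul_zero]
  · rw [div_mul_cancel₀ _ (h.self_pos l).ne']

end GramSchmidtData

end GramSchmidt

/-! ### The orthogonal polynomials -/

/-- The inner product of `L²(SG, μ)` on continuous functions. -/
noncomputable def ipForm : LinearMap.BilinForm ℝ C(Gasket q, ℝ) :=
  LinearMap.mk₂ ℝ (fun u v => ip q u v)
    (fun u v w => by
      simp only [ip, ContinuousMap.add_apply, add_mul]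
      exact integral_add (integrable_of_continuous (u.continuous.mul w.continuous))
        (integrable_of_continuous (v.continuous.mul w.continuous)))
    (fun r u w => by
      simp only [ip, ContinuousMap.smul_apply, smul_eq_mul, mul_assoc]
      exact integral_const_mul _ _)
    (fun u v w => by
      simp only [ip, ContinuousMap.add_apply, mul_add]
      exact integral_add (integrable_of_continuous (u.continuous.mul v.continuous))
        (integrable_of_continuous (u.continuous.mul w.continuous)))
    (fun r u w => by
      simp only [ip, ContinuousMap.smul_apply, smul_eq_mul, mul_left_comm _ r]
      exact integral_const_mul _ _)

theorem ipForm_apply (u v : C(Gasket q, ℝ)) : ipForm u v = ip q u v := rfl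

theorem ip_self_nonneg (u : Gasket q → ℝ) : 0 ≤ ip q u u :=
  integral_nonneg fun x => mul_self_nonneg (u x)

theorem ipForm_pos (u : C(Gasket q, ℝ)) (hu : u ≠ 0) : 0 < ipForm u u := by
  refine lt_of_le_of_ne (ip_self_nonneg _) fun h => hu ?_
  have h0 := eq_zero_of_integral_eq_zero (u := fun x => u x * u x)
    (u.continuous.mul u.continuous) (fun x => mul_self_nonneg (u x)) h.symm
  ext x
  exact mul_self_eq_zero.1 (congrFun h0 x)

/-- The solution operator of the Dirichlet problem on continuous functions. -/
noncomputable def potentialMap (hq : IsEquilateral q) : C(Gasket q, ℝ) →ₗ[ℝ] C(Gasket q, ℝ) where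
  toFun u := ⟨potential u, continuous_potential hq u.continuous⟩
  map_add' u v := ContinuousMap.ext
    (congrFun (potential_add hq u.continuous v.continuous))
  map_smul' r u := ContinuousMap.ext (congrFun (potential_smul r u))

/-- The monomials as continuous functions. -/
noncomputable def monoMap (hq : IsEquilateral q) (j : ℕ) : C(Gasket q, ℝ) :=
  ⟨mono j, continuous_mono hq j⟩

theorem linearIndependent_monoMap (hq : IsEquilateral q) :
    LinearIndependent ℝ (monoMap hq) :=
  LinearIndependent.of_comp (ContinuousMap.coeFnLinearMap ℝ) (linearIndependent_mono hq)

theorem continuous_p (hq : IsEquilateral q) (k : ℕ) : Continuous (p q k) := by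
  induction k using Nat.strong_induction_on with
  | _ k ih =>
    have h : p q k = fun x => mono k x - ∑ l : Fin k,
        (l2norm q (p q l))⁻¹ ^ 2 * ip q (mono k) (p q l) * p q l x := by
      funext x
      rw [p, monomial_eq_mono hq]
    rw [h]
    exact (continuous_mono hq k).sub (continuous_finsetSum _ fun l _ =>
      continuous_const.mul (ih l l.2))

/-- The orthogonal polynomials as continuous functions. -/
noncomputable def polyMap (hq : IsEquilateral q) (j : ℕ) : C(Gasket q, ℝ) :=
  ⟨p q j, continuous_p hq j⟩

theorem l2norm_sq (u : Gasket q → ℝ) : l2norm q u ^ 2 = ip q u u :=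
  Real.sq_sqrt (ip_self_nonneg u)

theorem gramSchmidtData (hq : IsEquilateral q) :
    GramSchmidtData ipForm (monoMap hq) (polyMap hq) where
  symm u v := by simp only [ipForm_apply, ip, mul_comm]
  pos := ipForm_pos
  indep := linearIndependent_monoMap hq
  step j := by
    ext x
    change p q j x = _
    rw [p, monomial_eq_mono hq, ContinuousMap.sub_apply, ContinuousMap.sum_apply,
      Fin.sum_univ_eq_sum_range fun l => (l2norm q (p q l))⁻¹ ^ 2 * ip q (mono j) (p q l) * p q l x]
    simp only [inv_pow, l2norm_sq]
    rfl

/-- By construction the next monomial differs from the potential of the present one by a multiple of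
$P_{03}$. -/
theorem potentialMap_monoMap (hq : IsEquilateral q) (j : ℕ) :
    potentialMap hq (monoMap hq j) - monoMap hq (j + 1) ∈ headSpan (monoMap hq) (j + 1) := by
  obtain ⟨t, ht⟩ : ∃ t : ℝ, potentialMap hq (monoMap hq j) - monoMap hq (j + 1)
      = t • monoMap hq 0 := by
    refine ⟨-(potential (mono j) (F q 0 (corner q 1)) / (scaling (j + 1) / 2 - 1 / 10)), ?_⟩
    ext x
    change potential (mono j) x - mono (j + 1) x = _ * mono 0 x
    simp only [mono, Pi.add_apply, Pi.smul_apply, smul_eq_mul]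
    ring
  rw [ht]
  exact Submodule.smul_mem _ _ (mem_headSpan _ j.succ_pos)

theorem l2norm_p_pos (hq : IsEquilateral q) (k : ℕ) : 0 < l2norm q (p q k) :=
  Real.sqrt_pos.2 ((gramSchmidtData hq).self_pos k)

theorem d_pos (hq : IsEquilateral q) (k : ℕ) : 0 < d q k := inv_pos.2 (l2norm_p_pos hq k)

theorem d_sq (k : ℕ) : d q k ^ 2 = (ip q (p q k) (p q k))⁻¹ := by
  rw [d, inv_pow, l2norm_sq]

theorem sqrt_c_succ (hq : IsEquilateral q) (k : ℕ) : √(c q (k + 1)) = d q k / d q (k + 1) := by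
  rw [c, ← div_pow, Real.sqrt_sq (div_pos (d_pos hq k) (d_pos hq (k + 1))).le]

theorem f_succ (hq : IsEquilateral q) (k : ℕ) : f q (k + 1) = potential (p q k) :=
  negGreenOp_eq_potential hq _

theorem ftilde_succ (hq : IsEquilateral q) (k : ℕ) (x : Gasket q) :
    ftilde q (k + 1) x = d q k * potential (p q k) x := by
  rw [ftilde, negGreenOp_eq_potential hq]
  exact congrFun (potential_smul (d q k) (p q k)) x

theorem b_eq (hq : IsEquilateral q) (k : ℕ) :
    b q k = (ip q (p q k) (p q k))⁻¹ * ip q (potential (p q k)) (p q k) := by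
  rw [b, d_sq, f_succ hq]

theorem potential_p_zero (hq : IsEquilateral q) (x : Gasket q) :
    potential (p q 0) x = p q 1 x + b q 0 * p q 0 x := by
  rw [b_eq hq]
  exact DFunLike.congr_fun ((gramSchmidtData hq).recursion_zero (potentialMap_monoMap hq)) x

theorem potential_p_succ (hq : IsEquilateral q) (k : ℕ) (x : Gasket q) :
    potential (p q (k + 1)) x = p q (k + 2) x + b q (k + 1) * p q (k + 1) x
      + d q k ^ 2 / d q (k + 1) ^ 2 * p q k x := by
  have h := DFunLike.congr_fun ((gramSchmidtData hq).recursion_succ (potentialMap_monoMap hq)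
    (fun u v => ip_potential_comm hq u.continuous v.continuous) k) x
  rw [b_eq hq, d_sq, d_sq, inv_div_inv]
  exact h

/-- Multiply the recursion for $p_k$ by $d_k$: then $d_kp_{k+1}=(d_k/d_{k+1})Q_{k+1}$ and
$c_kd_kp_{k-1}=(d_{k-1}/d_k)Q_{k-1}$. Positivity of the $d_k$ identifies these quotients with the
square roots. -/
theorem three_term_recursion (hq : IsEquilateral q) (k : ℕ) (x : Gasket q) :
    √(c q (k + 1)) * Q q (k + 1) x =
      ftilde q (k + 1) x - b q k * Q q k x - √(c q k) * Qprev q k x := by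
  have h1 := (d_pos hq (k + 1)).ne'
  rw [sqrt_c_succ hq, ftilde_succ hq]
  cases k with
  | zero =>
    rw [potential_p_zero hq]
    simp only [Q, Qprev, Pi.zero_apply]
    field_simp
    ring
  | succ k =>
    have h2 := (d_pos hq k).ne'
    have h3 := (d_pos hq (k + 1)).ne'
    rw [potential_p_succ hq, sqrt_c_succ hq]
    simp only [Q, Qprev]
    field_simp
    ring

end

end SierpinskiOP

/-! ### Well-definedness and the recursion -/

open SierpinskiOP in
theorem theorem3p4 (q : Fin 3 → Plane) (hq : IsEquilateral q) :
    -- the objects are well defined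
    (∀ j : ℕ, ∃! u : Gasket q → ℝ, IsMonomial q 0 3 j u) ∧
    (∀ x y : Gasket q, Tendsto (fun M => greenPartial q M x y) atTop (𝓝 (green q x y))) ∧
    (∀ k : ℕ, 0 < l2norm q (p q k)) ∧
    (∀ (k : ℕ) (x : Gasket q), Integrable (fun y => green q x y * Q q k y) (μ q)) ∧
    -- the recursion
    ∀ (k : ℕ) (x : Gasket q),
      √(c q (k + 1)) * Q q (k + 1) x =
        ftilde q (k + 1) x - b q k * Q q k x - √(c q k) * Qprev q k x := by
  refine ⟨fun j => ⟨mono j, isMonomial_mono hq j, fun u hu => hu.unique hq (isMonomial_mono hq j)⟩,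
    fun x y => ?_, l2norm_p_pos hq, fun k x => ?_, three_term_recursion hq⟩
  · rw [green_eq_greenFn hq]
    exact tendsto_greenPartial hq x y
  · simp only [green_eq_greenFn hq]
    exact integrable_greenFn_mul hq (continuous_const.mul (continuous_p hq k)) x
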